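/- Let $w$ be a $*$-word, i.e. a finite word over the formal alphabet $\{G_1,G_2,\dots\}\cup\{G_1^*,G_2^*,\dots\}$, and let $w^*$ be the word obtained from $w$ by reversing the order and replacing every letter by its conjugate transpose ($G_r\leftrightarrow G_r^*$). For every $N$ let $G_1,G_2,\dots$ be i.i.d. complex Ginibre matrices of order $N$: all entries of all the matrices are independent centred complex Gaussians of variance $1/N$ (independent real and imaginary parts, each a centred real Gaussian of variance $1/(2N)$). Let $G_w$ be the random $N\times N$ matrix obtained by substituting these matrices for the letters of $w$. To $*$-words $w_1,\dots,w_k$ associate $k$ oriented polygonal faces, the $l$-th edge of the $j$-th face being labelled by the $l$-th letter of $w_j$. An admissible pairing is a partition of all the edges into pairs such that two paired edges are labelled $G_r$ and $G_r^*$ for some $r$. Gluing paired edges so that the start of each edge (in the orientation of its face) is identified with the end of its partner yields a closed oriented surface, with a graph on it that has $V$ vertices, $E$ edges and $F=k$ faces; if it has $c$ connected components, its total genus $g$ is given by Euler's formula $V-E+F=2c-2g$. The pairing is spherical if the surface is a sphere, that is, if it is connected ($c=1$) and $g=0$. (An empty word contributes one face without edges, with a single vertex.) Let $a_w$, $b_w$,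 $c_w$ be the numbers of spherical pairings of $w$, of $(w,w^*)$ and of $(w,w)$, respectively. Then $c_w\le b_w$; for every $N$ the variable $\mathrm{Tr}(G_w)$ is integrable, and, as $N\to\infty$, $$\mathbb{E}\,\mathrm{Tr}(G_w)=a_wN+O\left(\frac1N\right);$$ moreover $$\mathrm{Tr}(G_w)-a_wN\ \xrightarrow[N\to\infty]{d}\ X+iY,$$ where $X,Y$ are independent centred real Gaussian variables of variances $\frac{b_w+c_w}{2}$ and $\frac{b_w-c_w}{2}$, respectively (a centred Gaussian of variance $0$ being the constant $0$). -/

import Mathlib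

open MeasureTheory ProbabilityTheory Filter Asymptotics
open scoped Topology Matrix

/-- A letter of the formal alphabet `{G_r} ∪ {G_r^*}`: an index `r` and a sign;
`star = true` stands for `G_r^*`, `star = false` for `G_r`. -/
structure StarLetter where
  index : ℕ
  star : Bool

/-- The same index, the opposite sign. -/
def StarLetter.conj (x : StarLetter) : StarLetter := ⟨x.index, !x.star⟩

/-- A `*`-word: a finite word over the alphabet `{G_r} ∪ {G_r^*}`. -/
abbrev StarWord : Type := List StarLetter

/-- The word `w^*`: reverse the order and replace every letter by its conjugate transpose. -/
def StarWord.adjoint (w : StarWord) : StarWord := (w.map StarLetter.conj).reverse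

section Gluing

/-- The edges of the polygonal faces of the words `ws 0, …, ws (k - 1)`; the `l`-th edge of the
`j`-th face carries the `l`-th letter of `ws j`. -/
abbrev FaceEdge {k : ℕ} (ws : Fin k → StarWord) : Type := Σ j : Fin k, Fin (ws j).length

/-- The letter carried by an edge. -/
def FaceEdge.label {k : ℕ} {ws : Fin k → StarWord} (e : FaceEdge ws) : StarLetter :=
  (ws e.1).get e.2

/-- A point `(j, p)` with `0 ≤ p ≤ |ws j|` on the boundary of the `j`-th face. The `l`-th edge goes
from the point `l` to the point `l + 1`; the last point coincides with the first, which is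
part of the relation `PointGlue` below. -/
abbrev FacePoint {k : ℕ} (ws : Fin k → StarWord) : Type := Σ j : Fin k, Fin ((ws j).length + 1)

/-- The point at which an edge begins, in the direct orientation of its face. -/
def FaceEdge.source {k : ℕ} {ws : Fin k → StarWord} (e : FaceEdge ws) : FacePoint ws :=
  ⟨e.1, e.2.castSucc⟩

/-- The point at which an edge ends, in the direct orientation of its face. -/
def FaceEdge.target {k : ℕ} {ws : Fin k → StarWord} (e : FaceEdge ws) : FacePoint ws :=
  ⟨e.1, e.2.succ⟩

/-- An admissible pairing of the edges of all the faces, given as the involution exchanging paired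
edges: two paired edges have the same index and opposite signs (so no edge is paired with
itself). -/
structure AdmissiblePairing {k : ℕ} (ws : Fin k → StarWord) where
  pair : FaceEdge ws → FaceEdge ws
  pair_pair : ∀ e, pair (pair e) = e
  label_pair : ∀ e, (pair e).label = e.label.conj

variable {k : ℕ} {ws : Fin k → StarWord}

/-- The identifications of boundary points of the faces in the surface `S_φ`. Each face closes up,
and paired edges are identified coherently with their arrows: the arrow of a `G_r`-edge follows the
direct orientation of its face and that of a `G_r^*`-edge the opposite one, so the source of an edge
is identified with the target of the edge paired with it (the other two ends are identified by the
same clause, applied to the paired edge). -/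
inductive AdmissiblePairing.PointGlue (φ : AdmissiblePairing ws) :
    FacePoint ws → FacePoint ws → Prop
  | close (j : Fin k) : PointGlue φ ⟨j, Fin.last _⟩ ⟨j, 0⟩
  | glue (e : FaceEdge ws) : PointGlue φ e.source (φ.pair e).target

/-- The vertices of the graph `Γ_φ` on `S_φ`: classes of boundary points of the faces under the
equivalence relation generated by the identifications. -/
abbrev AdmissiblePairing.Vertex (φ : AdmissiblePairing ws) : Type := Quot φ.PointGlue

/-- The edges of the graph `Γ_φ` on `S_φ`: pairs of identified edges of the faces. -/
abbrev AdmissiblePairing.GluedEdge (φ : AdmissiblePairing ws) : Type :=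
  Quot fun e e' : FaceEdge ws => e' = φ.pair e

/-- The connected components of `S_φ`: classes of faces under the equivalence relation generated by
sharing an edge. -/
abbrev AdmissiblePairing.Component (φ : AdmissiblePairing ws) : Type :=
  Quot fun j j' : Fin k => ∃ e : FaceEdge ws, e.1 = j ∧ (φ.pair e).1 = j'

/-- The Euler characteristic `V - E + F` of `S_φ`, computed from its decomposition into vertices,
edges and the `k` faces. -/
noncomputable def AdmissiblePairing.eulerChar (φ : AdmissiblePairing ws) : ℤ :=
  (Nat.card φ.Vertex : ℤ) - Nat.card φ.GluedEdge + k

/-- The total genus of `S_φ` (the sum of the genera of its components), given by Euler's formula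
`V - E + F = 2 c - 2 g`. -/
noncomputable def AdmissiblePairing.genus (φ : AdmissiblePairing ws) : ℚ :=
  (Nat.card φ.Component : ℚ) - (φ.eulerChar : ℚ) / 2

/-- The pairing is spherical: the closed oriented surface `S_φ` is a sphere, that is, it is
connected and has genus `0`. -/
def AdmissiblePairing.IsSpherical (φ : AdmissiblePairing ws) : Prop :=
  Nat.card φ.Component = 1 ∧ φ.genus = 0

/-- The number of spherical pairings of the words `ws 0, …, ws (k - 1)`. -/
noncomputable def sphericalCount {k : ℕ} (ws : Fin k → StarWord) : ℕ :=
  Nat.card {φ : AdmissiblePairing ws // φ.IsSpherical}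

end Gluing

/-- `a_w`, the number of spherical pairings of `w`. -/
noncomputable def StarWord.a (w : StarWord) : ℕ := sphericalCount ![w]

/-- `b_w`, the number of spherical pairings of `(w, w^*)`. -/
noncomputable def StarWord.b (w : StarWord) : ℕ := sphericalCount ![w, w.adjoint]

/-- `c_w`, the number of spherical pairings of `(w, w)`. -/
noncomputable def StarWord.c (w : StarWord) : ℕ := sphericalCount ![w, w]

/-- The centred complex Gaussian law of variance `v`: the law of `x + i y` where `x, y` are
independent centred real Gaussians of variance `v / 2`. -/
noncomputable def complexGaussian (v : NNReal) : Measure ℂ :=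
  ((gaussianReal 0 (v / 2)).prod (gaussianReal 0 (v / 2))).map
    fun p : ℝ × ℝ => (p.1 : ℂ) + (p.2 : ℂ) * Complex.I

/-- `G 0, G 1, …` are i.i.d. complex Ginibre matrices of order `N`: all the entries of all the
matrices are independent centred complex Gaussians of variance `1 / N`. -/
structure IsGinibreSequence {N : ℕ} {Ω : Type*} [MeasurableSpace Ω]
    (G : ℕ → Ω → Matrix (Fin N) (Fin N) ℂ) (P : Measure Ω) : Prop where
  hasLaw : ∀ r i j, HasLaw (fun ω => G r ω i j) (complexGaussian (1 / N)) P
  indep : iIndepFun (fun (q : ℕ × Fin N × Fin N) ω => G q.1 ω q.2.1 q.2.2) P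

/-- The matrix `G_w` obtained from `w` by replacing every letter by the appropriate matrix. -/
def wordMatrix {N : ℕ} (G : ℕ → Matrix (Fin N) (Fin N) ℂ) (w : StarWord) :
    Matrix (Fin N) (Fin N) ℂ :=
  (w.map fun x => if x.star then (G x.index)ᴴ else G x.index).prod

/-!
The moments of the traces are computed exactly by the genus expansion
(`integral_prod_trace_eq_sum_weight`): writing the traces as sums over closed paths of indices and
applying Wick's formula (`integral_prod_eq_card_matching`), the expectation of a product of `k`
traces is the sum of `N ^ (V - E)` over the admissible pairings. The vertices are the cycles of
the product of the rotation of the faces and the involution given by the pairing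
(`AdmissiblePairing.card_vertex`), so removing the pairs one at a time shows that `V - E + k` is
even and at most `2 c` (`AdmissiblePairing.card_vertex_add_le`). For one word this gives
`E Tr G_w = a_w N + O(1/N)`: by parity there is no term of order `1`.

The genus expansion is proved for words evaluated in independent copies of the matrices, assigned by
a colouring of the faces; then only the pairings respecting the colouring contribute. Giving some
faces colours of their own singles out the pairings in which these faces are isolated, and inclusion
and exclusion shows that centring the traces removes exactly the pairings with isolated faces
(`integral_prod_centredTrace_eq_sum_weight`). In the remaining ones every component has at least
two faces, so `V - E ≤ 2 c - k ≤ 0`, and only those count in which all the components consist of two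
faces. Sorting by the face which shares a component with the first one, and reading the colouring by
these two faces and the others as a factorization, yields
`E ∏ Y_l = ∑_j E (Y_0 Y_j) E ∏_{l ≠ 0, j} Y_l + O(1/N)` for centred traces `Y_l`
(`norm_integral_prod_centredTrace_sub_le`), while `E (Y_0 Y_1)` tends to the number of spherical
pairings of the two words.

Hence the moments of every real linear combination of the real and imaginary parts of the centred
trace satisfy in the limit the recursion `m_{n+2} = (n + 1) m_2 m_n` of a Gaussian law, whose
variance is computed from `b_w` and `c_w`; as a limit of variances it is nonnegative, whence
`c_w ≤ b_w`. Convergence of these moments implies that of the characteristic functions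
(`tendsto_integral_cexp_of_tendsto_moments`), and Lévy's theorem concludes.
-/

/-! ### Counting the cycles of a permutation -/

/-- Identifying two distinct points of a finite type lowers its cardinality by one. -/
lemma card_quot_pair_add_one {Q : Type*} [Finite Q] {a b : Q} (hab : a ≠ b) :
    Nat.card (Quot fun x y : Q => x = a ∧ y = b) + 1 = Nat.card Q := by
  classical
  have := Fintype.ofFinite Q
  have e : (Quot fun x y : Q => x = a ∧ y = b) ≃ {x : Q // x ≠ b} :=
    { toFun := Quot.lift (fun x => if h : x = b then ⟨a, hab⟩ else ⟨x, h⟩) (by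
        rintro x y ⟨rfl, rfl⟩
        simp [hab])
      invFun := fun x => Quot.mk _ x.1
      left_inv := by
        rintro ⟨x⟩
        by_cases h : x = b
        · simp only [h, dite_true]
          exact Quot.sound ⟨rfl, rfl⟩
        · simp [h]
      right_inv := by
        rintro ⟨x, hx⟩
        simp [hx] }
  rw [Nat.card_congr e, Nat.card_eq_fintype_card, Nat.card_eq_fintype_card,
    Fintype.card_subtype_compl, Fintype.card_subtype_eq]
  have : 0 < Fintype.card Q := Fintype.card_pos_iff.2 ⟨a⟩
  omega

/-- Two relations each of which is contained in the equivalence relation generated by the other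
have the same number of classes. -/
lemma card_quot_congr {D : Type*} {r s : D → D → Prop}
    (h₁ : ∀ x y, r x y → Quot.mk s x = Quot.mk s y)
    (h₂ : ∀ x y, s x y → Quot.mk r x = Quot.mk r y) :
    Nat.card (Quot r) = Nat.card (Quot s) :=
  Nat.card_congr
    { toFun := Quot.lift (Quot.mk s) h₁
      invFun := Quot.lift (Quot.mk r) h₂
      left_inv := by rintro ⟨x⟩; rfl
      right_inv := by rintro ⟨x⟩; rfl }

lemma card_quot_or_pair {D : Type*} (r : D → D → Prop) (a b : D) :
    Nat.card (Quot fun x y => r x y ∨ (x = a ∧ y = b)) =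
      Nat.card (Quot fun x y : Quot r => x = Quot.mk r a ∧ y = Quot.mk r b) :=
  Nat.card_congr
    { toFun := Quot.lift (fun x => Quot.mk _ (Quot.mk r x)) (by
        rintro x y (h | ⟨rfl, rfl⟩)
        · rw [Quot.sound h]
        · exact Quot.sound ⟨rfl, rfl⟩)
      invFun := Quot.lift (Quot.lift (Quot.mk _) fun x y h => Quot.sound (Or.inl h)) (by
        rintro _ _ ⟨rfl, rfl⟩
        exact Quot.sound (Or.inr ⟨rfl, rfl⟩))
      left_inv := by rintro ⟨x⟩; rfl
      right_inv := by rintro ⟨⟨x⟩⟩; rfl }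

lemma card_quot_or_pair_of_eq {D : Type*} {r : D → D → Prop} {a b : D}
    (h : Quot.mk r a = Quot.mk r b) :
    Nat.card (Quot fun x y => r x y ∨ (x = a ∧ y = b)) = Nat.card (Quot r) := by
  refine card_quot_congr ?_ fun x y hxy => Quot.sound (Or.inl hxy)
  rintro x y (hxy | ⟨rfl, rfl⟩)
  exacts [Quot.sound hxy, h]

lemma card_quot_or_pair_of_ne {D : Type*} [Finite D] {r : D → D → Prop} {a b : D}
    (h : Quot.mk r a ≠ Quot.mk r b) :
    Nat.card (Quot fun x y => r x y ∨ (x = a ∧ y = b)) + 1 = Nat.card (Quot r) := by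
  rw [card_quot_or_pair, card_quot_pair_add_one h]

namespace Equiv.Perm

variable {D : Type*}

/-- The number of cycles of a permutation, fixed points included. -/
noncomputable def cycleCount (σ : Perm D) : ℕ := Nat.card (Quot fun x y => y = σ x)

lemma quot_mk_eq_iff_sameCycle [Finite D] {σ : Perm D} {a b : D} :
    Quot.mk (fun x y => y = σ x) a = Quot.mk (fun x y => y = σ x) b ↔ σ.SameCycle a b := by
  constructor
  · intro h
    have h' := congrArg (Quot.lift (fun x => σ.SameCycle a x) (by
      rintro x y rfl
      simp)) h
    exact (iff_of_eq h').1 (SameCycle.refl σ a)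
  · intro h
    obtain ⟨n, -, rfl⟩ := h.exists_pow_eq'
    induction n with
    | zero => rfl
    | succ n ih =>
      rw [ih ⟨n, by simp⟩, pow_succ', mul_apply]
      exact Quot.sound rfl

variable [DecidableEq D]

/-- Multiplying by a transposition of points of different cycles puts them into the same cycle. -/
lemma sameCycle_mul_swap_of_not_sameCycle [Finite D] {σ : Perm D} {a b : D}
    (h : ¬ σ.SameCycle a b) : (σ * swap a b).SameCycle a b := by
  have key : ∀ n : ℕ, (σ * swap a b).SameCycle ((σ ^ (n + 1)) a) b := by
    intro n
    induction n with
    | zero =>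
      have : (σ ^ (0 + 1)) a = (σ * swap a b) b := by simp
      rw [this, sameCycle_apply_left]
    | succ n ih =>
      rw [pow_succ', mul_apply]
      by_cases hya : (σ ^ (n + 1)) a = a
      · have : σ ((σ ^ (n + 1)) a) = (σ * swap a b) b := by simp [hya]
        rw [this, sameCycle_apply_left]
      · have hyb : (σ ^ (n + 1)) a ≠ b := fun hb =>
          h ⟨((n + 1 : ℕ) : ℤ), by rw [zpow_natCast]; exact hb⟩
        have : σ ((σ ^ (n + 1)) a) = (σ * swap a b) ((σ ^ (n + 1)) a) := by
          rw [mul_apply, swap_apply_of_ne_of_ne hya hyb]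
        rw [this, sameCycle_apply_left]
        exact ih
  have hpos := orderOf_pos σ
  have := key (orderOf σ - 1)
  rwa [Nat.sub_add_cancel hpos, pow_orderOf_eq_one, one_apply] at this

/-- Multiplying by a transposition of points of the same cycle puts them into different cycles. -/
lemma not_sameCycle_mul_swap_of_sameCycle [Finite D] {σ : Perm D} {a b : D} (hab : a ≠ b)
    (h : σ.SameCycle a b) : ¬ (σ * swap a b).SameCycle a b := by
  intro h'
  have hex : ∃ m : ℕ, (σ ^ m) a = b := by
    obtain ⟨n, -, hn⟩ := h.exists_pow_eq'
    exact ⟨n, hn⟩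
  classical
  -- The arc of the cycle of `σ` from `σ a` to `b` is stable under `σ * swap a b` and avoids `a`.
  set m := Nat.find hex with hm
  have hmb : (σ ^ m) a = b := Nat.find_spec hex
  have hmin : ∀ i < m, (σ ^ i) a ≠ b := fun i hi => Nat.find_min hex hi
  have hm0 : m ≠ 0 := by
    intro h0
    rw [h0] at hmb
    exact hab (by simpa using hmb)
  have hna : ∀ i, 1 ≤ i → i ≤ m → (σ ^ i) a ≠ a := by
    intro i hi him hia
    refine hmin (m - i) (by omega) ?_
    rw [← hmb]
    conv_rhs => rw [← Nat.sub_add_cancel him, pow_add, mul_apply, hia]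
  have hstab : ∀ n : ℕ, ∃ i, 1 ≤ i ∧ i ≤ m ∧ ((σ * swap a b) ^ n) b = (σ ^ i) a := by
    intro n
    induction n with
    | zero => exact ⟨m, by omega, le_rfl, by simp [hmb]⟩
    | succ n ih =>
      obtain ⟨i, hi, him, hni⟩ := ih
      rw [pow_succ', mul_apply, hni]
      rcases him.eq_or_lt with rfl | hlt
      · exact ⟨1, le_rfl, by omega, by simp [hmb]⟩
      · refine ⟨i + 1, by omega, by omega, ?_⟩
        rw [mul_apply, swap_apply_of_ne_of_ne (hna i hi him) (hmin i hlt), pow_succ', mul_apply]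
  obtain ⟨n, -, hn⟩ := h'.symm.exists_pow_eq'
  obtain ⟨i, hi, him, hni⟩ := hstab n
  exact hna i hi him (hni ▸ hn)

lemma quot_mk_swap_apply (r : D → D → Prop) (a b x : D) :
    Quot.mk (fun x y => r x y ∨ (x = a ∧ y = b)) x = Quot.mk _ (swap a b x) := by
  rcases eq_or_ne x a with rfl | hxa
  · rw [swap_apply_left]
    exact Quot.sound (Or.inr ⟨rfl, rfl⟩)
  · rcases eq_or_ne x b with rfl | hxb
    · rw [swap_apply_right]
      exact Eq.symm (Quot.sound (by exact Or.inr ⟨rfl, rfl⟩))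
    · rw [swap_apply_of_ne_of_ne hxa hxb]

lemma card_quot_mul_swap_or_pair (σ : Perm D) (a b : D) :
    Nat.card (Quot fun x y => y = (σ * swap a b) x ∨ (x = a ∧ y = b)) =
      Nat.card (Quot fun x y => y = σ x ∨ (x = a ∧ y = b)) := by
  refine card_quot_congr ?_ ?_
  · rintro x y (rfl | h)
    · rw [quot_mk_swap_apply]
      exact Quot.sound (Or.inl rfl)
    · exact Quot.sound (Or.inr h)
  · rintro x y (rfl | h)
    · rw [quot_mk_swap_apply]
      exact Quot.sound (Or.inl (by simp))
    · exact Quot.sound (Or.inr h)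

lemma cycleCount_mul_swap_of_not_sameCycle [Finite D] {σ : Perm D} {a b : D}
    (h : ¬ σ.SameCycle a b) : cycleCount (σ * swap a b) + 1 = cycleCount σ := by
  unfold cycleCount
  rw [← card_quot_or_pair_of_eq
      (quot_mk_eq_iff_sameCycle.2 (sameCycle_mul_swap_of_not_sameCycle h)),
    card_quot_mul_swap_or_pair, card_quot_or_pair_of_ne (mt quot_mk_eq_iff_sameCycle.1 h)]

lemma cycleCount_mul_swap_of_sameCycle [Finite D] {σ : Perm D} {a b : D} (hab : a ≠ b)
    (h : σ.SameCycle a b) : cycleCount (σ * swap a b) = cycleCount σ + 1 := by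
  unfold cycleCount
  rw [← card_quot_or_pair_of_eq (quot_mk_eq_iff_sameCycle.2 h), ← card_quot_mul_swap_or_pair,
    card_quot_or_pair_of_ne
      (mt quot_mk_eq_iff_sameCycle.1 (not_sameCycle_mul_swap_of_sameCycle hab h))]

/-- Nonnegativity and integrality of the genus, for a permutation `γ` (faces) and an involution
`τ` (gluing of edges) with `m` transpositions: the cycles of `γ * τ` are the vertices, and the
orbits of the group generated by `γ` and `τ` the components. Removing one transposition
`(a b)` from `τ` changes the number of vertices by one, upwards if `a` and `b` lie in different
components after the removal. -/
theorem cycleCount_mul_add_le_of_involutive [Fintype D] (γ : Perm D) (m : ℕ) (τ : Perm D)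
    (hτ : ∀ x, τ (τ x) = x) (hm : τ.support.card = 2 * m) :
    cycleCount (γ * τ) + cycleCount γ ≤
        m + 2 * Nat.card (Quot fun x y => y = γ x ∨ y = τ x) ∧
      Even (cycleCount (γ * τ) + cycleCount γ + m) := by
  induction m generalizing τ with
  | zero =>
    have h1 : τ = 1 := by simpa using hm
    subst h1
    have : Nat.card (Quot fun x y => y = γ x ∨ y = (1 : Perm D) x) = cycleCount γ := by
      refine card_quot_congr ?_ fun x y h => Quot.sound (Or.inl h)
      rintro x y (rfl | rfl)
      exacts [Quot.sound rfl, rfl]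
    rw [this, mul_one]
    exact ⟨by omega, ⟨cycleCount γ, by omega⟩⟩
  | succ m ih =>
    obtain ⟨a, ha⟩ : τ.support.Nonempty := by
      rw [← Finset.card_pos]
      omega
    have hne : τ a ≠ a := mem_support.1 ha
    obtain ⟨b, hb⟩ : ∃ b, b = τ a := ⟨_, rfl⟩
    have hba : τ b = a := by rw [hb, hτ]
    have hab : a ≠ b := by
      rw [hb]
      exact hne.symm
    set τ' := τ * swap a b with hτ'
    have e1 : τ' a = a := by simp [hτ', hba]
    have e2 : τ' b = b := by simp [hτ', ← hb]
    have e3 : ∀ x, x ≠ a → x ≠ b → τ' x = τ x := fun x h1 h2 => by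
      rw [hτ', mul_apply, swap_apply_of_ne_of_ne h1 h2]
    have hττ' : τ = τ' * swap a b := by simp [hτ', mul_assoc]
    have hinv : ∀ x, τ' (τ' x) = x := by
      intro x
      by_cases h1 : x = a
      · rw [h1, e1, e1]
      by_cases h2 : x = b
      · rw [h2, e2, e2]
      rw [e3 x h1 h2, e3, hτ]
      · intro h
        exact h2 (by rw [hb, ← h, hτ])
      · intro h
        exact h1 (by rw [← hba, ← h, hτ])
    have hsupp : τ.support = insert a (insert b τ'.support) := by
      ext x
      simp only [mem_support, Finset.mem_insert]
      by_cases h1 : x = a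
      · simp [h1, hne]
      by_cases h2 : x = b
      · simp [h2, hba, hab]
      simp [h1, h2, e3 x h1 h2]
    have hcard : τ'.support.card = 2 * m := by
      rw [hsupp, Finset.card_insert_of_notMem (by simp [hab, e1]),
        Finset.card_insert_of_notMem (by simp [e2])] at hm
      omega
    obtain ⟨ih1, ih2⟩ := ih τ' hinv hcard
    have hc : Nat.card (Quot fun x y => y = γ x ∨ y = τ x) =
        Nat.card (Quot fun x y => (y = γ x ∨ y = τ' x) ∨ (x = a ∧ y = b)) := by
      refine card_quot_congr ?_ ?_
      · rintro x y (rfl | rfl)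
        · exact Quot.sound (Or.inl (Or.inl rfl))
        · by_cases h1 : x = a
          · rw [h1, ← hb]
            exact Quot.sound (Or.inr ⟨rfl, rfl⟩)
          by_cases h2 : x = b
          · rw [h2, hba]
            exact Eq.symm (Quot.sound (by exact Or.inr ⟨rfl, rfl⟩))
          · exact Quot.sound (Or.inl (Or.inr (e3 x h1 h2).symm))
      · rintro x y ((rfl | rfl) | ⟨rfl, rfl⟩)
        · exact Quot.sound (Or.inl rfl)
        · by_cases h1 : x = a
          · rw [h1, e1]
          by_cases h2 : x = b
          · rw [h2, e2]
          · exact Quot.sound (Or.inr (e3 x h1 h2))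
        · exact Quot.sound (Or.inr hb)
    have hγτ : γ * τ = γ * τ' * swap a b := by rw [mul_assoc, ← hττ']
    rw [hc, hγτ]
    by_cases hs : (γ * τ').SameCycle a b
    · rw [cycleCount_mul_swap_of_sameCycle hab hs]
      have hq : Quot.mk (fun x y => y = γ x ∨ y = τ' x) a =
          Quot.mk (fun x y => y = γ x ∨ y = τ' x) b := by
        rw [← quot_mk_eq_iff_sameCycle] at hs
        exact congrArg (Quot.lift (Quot.mk (fun x y => y = γ x ∨ y = τ' x)) (by
          rintro x y rfl
          exact Eq.trans (b := Quot.mk _ (τ' x)) (Quot.sound (Or.inr rfl))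
            (Quot.sound (Or.inl rfl)))) hs
      rw [card_quot_or_pair_of_eq hq]
      exact ⟨by omega, by grind⟩
    · have h1 := cycleCount_mul_swap_of_not_sameCycle hs
      have h2 : Nat.card (Quot fun x y => y = γ x ∨ y = τ' x) ≤
          Nat.card (Quot fun x y => (y = γ x ∨ y = τ' x) ∨ (x = a ∧ y = b)) + 1 := by
        by_cases hq : Quot.mk (fun x y => y = γ x ∨ y = τ' x) a =
          Quot.mk (fun x y => y = γ x ∨ y = τ' x) b
        · rw [card_quot_or_pair_of_eq hq]
          omega
        · rw [card_quot_or_pair_of_ne hq]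
      exact ⟨by omega, by grind⟩

end Equiv.Perm

/-! ### The genus of a glued surface -/

@[simp] lemma StarLetter.star_conj (x : StarLetter) : x.conj.star = !x.star := rfl

@[simp] lemma StarLetter.index_conj (x : StarLetter) : x.conj.index = x.index := rfl

section Genus

variable {k : ℕ} {ws : Fin k → StarWord}

lemma FacePoint.eq_last_or_source (x : FacePoint ws) :
    (x = ⟨x.1, Fin.last _⟩) ∨ ∃ e : FaceEdge ws, x = e.source := by
  obtain ⟨j, p⟩ := x
  induction p using Fin.lastCases with
  | last => exact Or.inl rfl
  | cast l => exact Or.inr ⟨⟨j, l⟩, rfl⟩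

lemma FaceEdge.source_injective : Function.Injective (FaceEdge.source (ws := ws)) := by
  rintro ⟨j, l⟩ ⟨j', l'⟩ h
  simp only [FaceEdge.source, Sigma.mk.injEq] at h
  obtain ⟨rfl, h⟩ := h
  simpa using h

/-- The rotation of every face: a point of the boundary goes to the next one, and the last point to
the first. -/
def faceRotation (ws : Fin k → StarWord) : Equiv.Perm (FacePoint ws) :=
  Equiv.sigmaCongrRight fun _ => finRotate _

lemma faceRotation_source (e : FaceEdge ws) : faceRotation ws e.source = e.target := by
  obtain ⟨j, l⟩ := e
  simp [faceRotation, FaceEdge.source, FaceEdge.target]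

lemma faceRotation_last (j : Fin k) : faceRotation ws ⟨j, Fin.last _⟩ = ⟨j, 0⟩ := by
  simp [faceRotation]

lemma cycleCount_faceRotation (ws : Fin k → StarWord) :
    (faceRotation ws).cycleCount = k := by
  have h0 : ∀ (j : Fin k) (p : Fin ((ws j).length + 1)),
      (Quot.mk (fun x y => y = faceRotation ws x) ⟨j, p⟩ : Quot _) = Quot.mk _ ⟨j, 0⟩ := by
    intro j p
    induction p using Fin.induction with
    | zero => rfl
    | succ l ih =>
      rw [← ih]
      refine Eq.symm (Quot.sound ?_)
      exact (faceRotation_source ⟨j, l⟩).symm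
  rw [Equiv.Perm.cycleCount, Nat.card_congr (β := Fin k), Nat.card_eq_fintype_card,
    Fintype.card_fin]
  exact
    { toFun := Quot.lift Sigma.fst (by rintro x y rfl; rfl)
      invFun := fun j => Quot.mk _ ⟨j, 0⟩
      left_inv := by rintro ⟨j, p⟩; exact (h0 j p).symm
      right_inv := fun j => rfl }

namespace AdmissiblePairing

variable (φ : AdmissiblePairing ws)

lemma star_pair (e : FaceEdge ws) : (φ.pair e).label.star = !e.label.star := by
  simp [φ.label_pair]

lemma pair_ne (e : FaceEdge ws) : φ.pair e ≠ e := fun h => by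
  have := φ.star_pair e
  rw [h] at this
  simp at this

/-- The pairing as an involution of the boundary points: an edge is represented by its source, and
the last point of each face, which is the source of no edge, is fixed. -/
def pointMap (x : FacePoint ws) : FacePoint ws :=
  Fin.lastCases (motive := fun _ => FacePoint ws) ⟨x.1, Fin.last _⟩
    (fun l => (φ.pair ⟨x.1, l⟩).source) x.2

lemma pointMap_last (j : Fin k) : φ.pointMap ⟨j, Fin.last _⟩ = ⟨j, Fin.last _⟩ := by
  simp [pointMap]

lemma pointMap_source (e : FaceEdge ws) : φ.pointMap e.source = (φ.pair e).source := by
  obtain ⟨j, l⟩ := e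
  simp [pointMap, FaceEdge.source]

lemma pointMap_pointMap (x : FacePoint ws) : φ.pointMap (φ.pointMap x) = x := by
  rcases x.eq_last_or_source with h | ⟨e, rfl⟩
  · rw [h, pointMap_last, pointMap_last]
  · rw [pointMap_source, pointMap_source, φ.pair_pair]

/-- `pointMap` as a permutation. -/
def pointPerm : Equiv.Perm (FacePoint ws) := Function.Involutive.toPerm _ φ.pointMap_pointMap

@[simp] lemma pointPerm_apply (x : FacePoint ws) : φ.pointPerm x = φ.pointMap x := rfl

/-- The identifications of the boundary points are the graph of a permutation, so the vertices are
its cycles. -/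
lemma pointGlue_iff (x y : FacePoint ws) :
    φ.PointGlue x y ↔ y = (faceRotation ws * φ.pointPerm) x := by
  rw [Equiv.Perm.mul_apply, pointPerm_apply]
  constructor
  · rintro (j | e)
    · rw [pointMap_last, faceRotation_last]
    · rw [pointMap_source, faceRotation_source]
  · rintro rfl
    rcases x.eq_last_or_source with h | ⟨e, rfl⟩
    · rw [h, pointMap_last, faceRotation_last]
      exact PointGlue.close _
    · rw [pointMap_source, faceRotation_source]
      exact PointGlue.glue e

lemma card_vertex : Nat.card φ.Vertex = (faceRotation ws * φ.pointPerm).cycleCount := by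
  have : φ.PointGlue = fun x y => y = (faceRotation ws * φ.pointPerm) x := by
    ext x y
    exact φ.pointGlue_iff x y
  rw [Equiv.Perm.cycleCount, Vertex, this]

lemma card_component : Nat.card φ.Component =
    Nat.card (Quot fun x y : FacePoint ws => y = faceRotation ws x ∨ y = φ.pointPerm x) := by
  have h0 : ∀ (j : Fin k) (p : Fin ((ws j).length + 1)),
      (Quot.mk (fun x y => y = faceRotation ws x ∨ y = φ.pointPerm x) ⟨j, p⟩ : Quot _) =
        Quot.mk _ ⟨j, 0⟩ := by
    intro j p
    induction p using Fin.induction with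
    | zero => rfl
    | succ l ih =>
      rw [← ih]
      refine Eq.symm (Quot.sound ?_)
      exact Or.inl (faceRotation_source ⟨j, l⟩).symm
  refine Nat.card_congr
    { toFun := Quot.lift (fun j => Quot.mk _ ⟨j, 0⟩) ?_
      invFun := Quot.lift (fun x => Quot.mk _ x.1) ?_
      left_inv := ?_
      right_inv := ?_ }
  · rintro _ _ ⟨e, rfl, rfl⟩
    rw [← h0 e.1 e.2.castSucc, ← h0 (φ.pair e).1 (φ.pair e).2.castSucc]
    exact Quot.sound (Or.inr (φ.pointMap_source e).symm)
  · rintro x y (rfl | rfl)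
    · rfl
    · rcases x.eq_last_or_source with h | ⟨e, rfl⟩
      · rw [h, pointPerm_apply, pointMap_last]
      · rw [pointPerm_apply, pointMap_source]
        exact Quot.sound ⟨e, rfl, rfl⟩
  · rintro ⟨j⟩
    rfl
  · rintro ⟨j, p⟩
    exact (h0 j p).symm

/-- Every glued edge consists of an edge labelled `G_r` and an edge labelled `G_r^*`. -/
lemma card_gluedEdge :
    Nat.card φ.GluedEdge = Fintype.card {e : FaceEdge ws // e.label.star = false} := by
  rw [← Nat.card_eq_fintype_card]
  refine Nat.card_congr
    { toFun := Quot.lift (fun e => if h : e.label.star = false then ⟨e, h⟩ else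
        ⟨φ.pair e, by simpa [φ.star_pair] using h⟩) ?_
      invFun := fun e => Quot.mk _ e.1
      left_inv := ?_
      right_inv := ?_ }
  · rintro e _ rfl
    have h := φ.star_pair e
    by_cases he : e.label.star = false <;> simp [h, he, φ.pair_pair]
  · rintro ⟨e⟩
    by_cases he : e.label.star = false
    · simp [he]
    · simp only [dif_neg he]
      refine Eq.symm (Quot.sound ?_)
      exact rfl
  · rintro ⟨e, he⟩
    simp [he]

lemma card_faceEdge (φ : AdmissiblePairing ws) :
    Fintype.card (FaceEdge ws) = 2 * Fintype.card {e : FaceEdge ws // e.label.star = false} := by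
  have h : Fintype.card {e : FaceEdge ws // ¬ e.label.star = false} =
      Fintype.card {e : FaceEdge ws // e.label.star = false} :=
    Fintype.card_congr
      { toFun := fun e => ⟨φ.pair e.1, by simpa [φ.star_pair] using e.2⟩
        invFun := fun e => ⟨φ.pair e.1, by simp [φ.star_pair, e.2]⟩
        left_inv := fun e => Subtype.ext (φ.pair_pair _)
        right_inv := fun e => Subtype.ext (φ.pair_pair _) }
  have := Fintype.card_subtype_compl fun e : FaceEdge ws => e.label.star = false
  have := Fintype.card_subtype_le fun e : FaceEdge ws => e.label.star = false
  omega

lemma card_support_pointPerm :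
    φ.pointPerm.support.card = 2 * Nat.card φ.GluedEdge := by
  rw [card_gluedEdge, ← card_faceEdge φ, ← Finset.card_univ,
    ← Finset.card_map ⟨_, FaceEdge.source_injective (ws := ws)⟩]
  congr 1
  ext x
  simp only [Equiv.Perm.mem_support, Finset.mem_map, Finset.mem_univ, true_and,
    Function.Embedding.coeFn_mk, pointPerm_apply]
  constructor
  · intro h
    rcases x.eq_last_or_source with h' | ⟨e, rfl⟩
    · rw [h', pointMap_last] at h
      exact absurd rfl h
    · exact ⟨e, rfl⟩
  · rintro ⟨e, rfl⟩
    rw [pointMap_source]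
    exact fun h => φ.pair_ne e (FaceEdge.source_injective h)

/-- The total genus is a natural number: `V - E + F` is even and at most `2 c`. -/
theorem card_vertex_add_le :
    Nat.card φ.Vertex + k ≤ Nat.card φ.GluedEdge + 2 * Nat.card φ.Component ∧
      Even (Nat.card φ.Vertex + k + Nat.card φ.GluedEdge) := by
  have := Equiv.Perm.cycleCount_mul_add_le_of_involutive (faceRotation ws)
    (Nat.card φ.GluedEdge) φ.pointPerm φ.pointMap_pointMap φ.card_support_pointPerm
  rwa [cycleCount_faceRotation, ← card_vertex, ← card_component] at this

lemma isSpherical_iff :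
    φ.IsSpherical ↔ Nat.card φ.Component = 1 ∧
      Nat.card φ.Vertex + k = Nat.card φ.GluedEdge + 2 := by
  refine and_congr_right fun h => ?_
  rw [genus, eulerChar, h]
  push_cast
  constructor
  · intro h'
    have : (Nat.card φ.Vertex + k : ℚ) = Nat.card φ.GluedEdge + 2 := by linarith
    exact_mod_cast this
  · intro h'
    have : (Nat.card φ.Vertex + k : ℚ) = Nat.card φ.GluedEdge + 2 := by exact_mod_cast h'
    linarith

end AdmissiblePairing

end Genus

/-! ### Moments of complex Gaussian variables -/

instance (v : NNReal) : IsProbabilityMeasure (complexGaussian v) := by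
  unfold complexGaussian
  exact Measure.isProbabilityMeasure_map (by fun_prop)

/-- The density of the complex Gaussian law with respect to the Lebesgue measure. -/
lemma integral_complexGaussian {v : NNReal} (hv : v ≠ 0) {f : ℂ → ℂ} (hf : Continuous f) :
    ∫ z, f z ∂(complexGaussian v) =
      ∫ z : ℂ, ((Real.pi * v)⁻¹ * Real.exp (-(v : ℝ)⁻¹ * ‖z‖ ^ (2 : ℝ))) • f z := by
  have hv2 : v / 2 ≠ 0 := by positivity
  rw [complexGaussian, integral_map (by fun_prop) hf.aestronglyMeasurable,
    gaussianReal_of_var_ne_zero _ hv2,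
    prod_withDensity (measurable_gaussianPDF _ _) (measurable_gaussianPDF _ _),
    integral_withDensity_eq_integral_toReal_smul (by fun_prop)
      (ae_of_all _ fun p => ENNReal.mul_lt_top gaussianPDF_lt_top gaussianPDF_lt_top),
    ← Measure.volume_eq_prod,
    ← Complex.volume_preserving_equiv_real_prod.integral_comp
      Complex.measurableEquivRealProd.measurableEmbedding]
  refine integral_congr_ae (ae_of_all _ fun z => ?_)
  simp only [Complex.measurableEquivRealProd_apply, ENNReal.toReal_mul, toReal_gaussianPDF,
    Complex.re_add_im]
  congr 1
  simp only [gaussianPDFReal, sub_zero, NNReal.coe_div, NNReal.coe_ofNat]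
  have hv0 : (0 : ℝ) < v := by positivity
  rw [mul_mul_mul_comm, ← Real.exp_add, ← mul_inv, Real.mul_self_sqrt (by positivity),
    Real.rpow_two, ← Complex.normSq_eq_norm_sq, Complex.normSq_apply]
  congr 2 <;> field_simp
  ring

lemma integral_pow_mul_conj_pow_complexGaussian {v : NNReal} (hv : v ≠ 0) (m n : ℕ) :
    ∫ z, z ^ m * (starRingEnd ℂ z) ^ n ∂(complexGaussian v) =
      if m = n then (v : ℂ) ^ n * n.factorial else 0 := by
  rw [integral_complexGaussian hv (by fun_prop)]
  have hv0 : (0 : ℝ) < v := by positivity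
  split_ifs with hmn
  · subst hmn
    have h1 : ∀ z : ℂ, ((Real.pi * v)⁻¹ * Real.exp (-(v : ℝ)⁻¹ * ‖z‖ ^ (2 : ℝ))) •
        (z ^ m * (starRingEnd ℂ z) ^ m) =
        (((Real.pi * v)⁻¹ *
          (‖z‖ ^ (2 * m : ℝ) * Real.exp (-(v : ℝ)⁻¹ * ‖z‖ ^ (2 : ℝ))) : ℝ) : ℂ) := by
      intro z
      rw [← mul_pow, Complex.mul_conj, Complex.normSq_eq_norm_sq, Real.rpow_mul (norm_nonneg z),
        Real.rpow_two, Real.rpow_natCast, Complex.real_smul]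
      push_cast
      ring
    simp_rw [h1]
    rw [integral_complex_ofReal, integral_const_mul,
      Complex.integral_rpow_mul_exp_neg_mul_rpow one_le_two
        (by linarith [m.cast_nonneg (α := ℝ)]) (inv_pos.2 hv0)]
    have h2 : (2 * m + 2 : ℝ) / 2 = m + 1 := by ring
    have h3 : -(2 * m + 2 : ℝ) / 2 = -((m + 1 : ℕ) : ℝ) := by push_cast; ring
    rw [h2, h3, Real.Gamma_nat_eq_factorial, Real.rpow_neg (by positivity), Real.rpow_natCast,
      inv_pow, inv_inv]
    have : (Real.pi * (v : ℝ))⁻¹ * (2 * Real.pi / 2 * (v : ℝ) ^ (m + 1) * m.factorial) =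
        (v : ℝ) ^ m * m.factorial := by
      have := Real.pi_ne_zero
      rw [pow_succ]
      field_simp
    rw [this]
    push_cast
    rfl
  · -- The law is invariant under rotations; a suitable one changes the sign of the integrand.
    set θ : ℝ := Real.pi / ((m : ℝ) - n) with hθ
    have hmn' : (m : ℝ) - n ≠ 0 := sub_ne_zero.2 (by exact_mod_cast hmn)
    have hu : (Circle.exp θ : ℂ) ^ m * (starRingEnd ℂ (Circle.exp θ : ℂ)) ^ n = -1 := by
      rw [Circle.coe_exp, ← Complex.exp_conj, ← Complex.exp_nat_mul, ← Complex.exp_nat_mul,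
        ← Complex.exp_add, ← Complex.exp_pi_mul_I]
      congr 1
      have : (Real.pi : ℂ) = θ * (m - n) := by
        rw [hθ]
        push_cast
        rw [div_mul_cancel₀]
        exact_mod_cast hmn'
      rw [this]
      simp
      ring
    set F : ℂ → ℂ := fun z => ((Real.pi * v)⁻¹ * Real.exp (-(v : ℝ)⁻¹ * ‖z‖ ^ (2 : ℝ))) •
      (z ^ m * (starRingEnd ℂ z) ^ n) with hF
    have h1 : ∫ z, F (rotation (Circle.exp θ) z) = ∫ z, F z :=
      (rotation (Circle.exp θ)).measurePreserving.integral_comp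
        (rotation (Circle.exp θ)).toHomeomorph.measurableEmbedding F
    have h2 : ∀ z, F (rotation (Circle.exp θ) z) = -F z := by
      intro z
      simp only [hF, rotation_apply, norm_mul, Circle.norm_coe, one_mul, map_mul, mul_pow]
      rw [mul_mul_mul_comm, hu, neg_one_mul, smul_neg]
    simp_rw [h2, integral_neg] at h1
    have : (∫ z, F z) = 0 := by
      have h3 : (2 : ℂ) * ∫ z, F z = 0 := by linear_combination -h1
      simpa using h3
    exact this

/-- All the moments of a random variable are finite. -/
def HasMoments {Ω : Type*} [MeasurableSpace Ω] (P : Measure Ω) (f : Ω → ℂ) : Prop :=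
  ∀ p : ℕ, MemLp f p P

namespace HasMoments

variable {Ω : Type*} [MeasurableSpace Ω] {P : Measure Ω} {f g : Ω → ℂ}

lemma integrable (hf : HasMoments P f) : Integrable f P :=
  memLp_one_iff_integrable.1 (by simpa using hf 1)

lemma const [IsFiniteMeasure P] (c : ℂ) : HasMoments P fun _ => c := fun _ => memLp_const c

lemma add (hf : HasMoments P f) (hg : HasMoments P g) : HasMoments P fun ω => f ω + g ω :=
  fun p => (hf p).add (hg p)

lemma sub (hf : HasMoments P f) (hg : HasMoments P g) : HasMoments P fun ω => f ω - g ω :=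
  fun p => (hf p).sub (hg p)

lemma mul (hf : HasMoments P f) (hg : HasMoments P g) : HasMoments P fun ω => f ω * g ω := by
  intro p
  have : ENNReal.HolderTriple ((2 * p : ℕ) : ENNReal) ((2 * p : ℕ) : ENNReal) (p : ENNReal) := by
    constructor
    rcases Nat.eq_zero_or_pos p with rfl | hp
    · simp
    · have hp' : (p : ENNReal) ≠ 0 := by exact_mod_cast hp.ne'
      push_cast
      rw [ENNReal.mul_inv (by simp) (by simp), ← add_mul, ENNReal.inv_two_add_inv_two, one_mul]
  exact (hg (2 * p)).mul' (hf (2 * p))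

lemma sum [IsFiniteMeasure P] {ι : Type*} (s : Finset ι) {f : ι → Ω → ℂ}
    (hf : ∀ i ∈ s, HasMoments P (f i)) : HasMoments P fun ω => ∑ i ∈ s, f i ω :=
  fun p => memLp_finsetSum s fun i hi => hf i hi p

lemma prod [IsFiniteMeasure P] {ι : Type*} (s : Finset ι) {f : ι → Ω → ℂ}
    (hf : ∀ i ∈ s, HasMoments P (f i)) : HasMoments P fun ω => ∏ i ∈ s, f i ω := by
  classical
  induction s using Finset.induction_on with
  | empty => simpa using const 1
  | insert a s ha ih =>
    simp only [Finset.prod_insert ha]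
    exact (hf a (by simp)).mul (ih fun i hi => hf i (by simp [hi]))

lemma conj (hf : HasMoments P f) : HasMoments P fun ω => starRingEnd ℂ (f ω) := fun p =>
  (hf p).star

lemma integrable_prod [IsFiniteMeasure P] {ι : Type*} (s : Finset ι) {f : ι → Ω → ℂ}
    (hf : ∀ i ∈ s, HasMoments P (f i)) : Integrable (fun ω => ∏ i ∈ s, f i ω) P :=
  (prod s hf).integrable

end HasMoments

lemma memLp_id_complexGaussian (v : NNReal) (p : ℕ) :
    MemLp (fun z : ℂ => z) p (complexGaussian v) := by
  rw [complexGaussian, memLp_map_measure_iff (by fun_prop) (by fun_prop)]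
  have h : MemLp (fun x : ℝ => (x : ℂ)) p (gaussianReal 0 (v / 2)) :=
    (memLp_id_gaussianReal' p (by simp)).ofReal
  exact (h.comp_fst _).add ((h.comp_snd _).mul_const Complex.I)

lemma HasMoments.of_hasLaw {Ω : Type*} [MeasurableSpace Ω] {P : Measure Ω} {v : NNReal}
    {f : Ω → ℂ} (hf : HasLaw f (complexGaussian v) P) : HasMoments P f := fun p => by
  have := memLp_id_complexGaussian v p
  rw [← hf.map_eq, memLp_map_measure_iff (by fun_prop) hf.aemeasurable] at this
  exact this

/-! ### Wick's formula -/

section Matching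

open Nat

variable {Q : Type*} [Fintype Q] [DecidableEq Q]

/-- The number of bijections between two finite types over a third one. -/
lemma card_equiv_over {A B : Type*} [Fintype A] [Fintype B] (f : A → Q) (g : B → Q) :
    Nat.card {e : A ≃ B // ∀ a, g (e a) = f a} =
      ∏ x, if Fintype.card {a // f a = x} = Fintype.card {b // g b = x} then
        (Fintype.card {b // g b = x})! else 0 := by
  classical
  by_cases h : ∀ x, Fintype.card {a // f a = x} = Fintype.card {b // g b = x}
  · have hx : ∀ x, Nonempty ({a // f a = x} ≃ {b // g b = x}) := fun x => Fintype.card_eq.1 (h x)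
    set e₀ := fun x => (hx x).some
    set E : A ≃ B := Equiv.ofFiberEquiv e₀ with hE
    have hEg : ∀ a, g (E a) = f a := fun a => Equiv.ofFiberEquiv_map e₀ a
    have hEg' : ∀ b, f (E.symm b) = g b := fun b => by rw [← hEg, E.apply_symm_apply]
    have e : {e : A ≃ B // ∀ a, g (e a) = f a} ≃ {σ : Equiv.Perm A // f ∘ σ = f} :=
      { toFun := fun e => ⟨e.1.trans E.symm, by
          ext a
          simp [hEg', e.2]⟩
        invFun := fun σ => ⟨σ.1.trans E, fun a => by
          simpa [hEg] using congrFun σ.2 a⟩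
        left_inv := fun e => by ext; simp
        right_inv := fun σ => by ext; simp }
    rw [Nat.card_congr e, Nat.card_eq_fintype_card, DomMulAct.stabilizer_card]
    exact Finset.prod_congr rfl fun x _ => by rw [if_pos (h x), h x]
  · push Not at h
    obtain ⟨x, hx⟩ := h
    rw [Finset.prod_eq_zero (Finset.mem_univ x) (if_neg hx), Nat.card_eq_zero]
    refine Or.inl ⟨fun e => hx (Fintype.card_congr ?_)⟩
    exact e.1.subtypeEquiv fun a => by rw [e.2]

/-- Fixed-point-free involutions exchanging the points of the two signs are the same as bijections
from the points of one sign to those of the other. -/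
def signedInvolutionEquiv {D : Type*} (s : D → Bool) (q : D → Q) :
    {f : D → D // (∀ e, f (f e) = e) ∧ (∀ e, s (f e) = !s e) ∧ ∀ e, q (f e) = q e} ≃
      {e : {x // s x = false} ≃ {x // s x = true} // ∀ a, q (e a) = q a} where
  toFun f := ⟨
    { toFun := fun x => ⟨f.1 x, by simp [f.2.2.1, x.2]⟩
      invFun := fun x => ⟨f.1 x, by simp [f.2.2.1, x.2]⟩
      left_inv := fun x => Subtype.ext (f.2.1 _)
      right_inv := fun x => Subtype.ext (f.2.1 _) }, fun a => f.2.2.2 _⟩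
  invFun e := ⟨fun x => if h : s x = false then (e.1 ⟨x, h⟩).1 else
      (e.1.symm ⟨x, by simpa using h⟩).1, by
    have hs : ∀ y : {x // s x = true}, ¬ s y.1 = false := fun y => by simp [y.2]
    have hq : ∀ y, q (e.1.symm y) = q y := fun y => by
      rw [← e.2, e.1.apply_symm_apply]
    refine ⟨fun x => ?_, fun x => ?_, fun x => ?_⟩
    · by_cases h : s x = false
      · simp [h, hs]
      · simp [h, (e.1.symm _).2]
    · by_cases h : s x = false
      · simp [h, (e.1 _).2]
      · simp [h, (e.1.symm _).2]
    · by_cases h : s x = false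
      · simp [h, e.2]
      · simp [h, hq]⟩
  left_inv f := by
    ext x
    by_cases h : s x = false <;> simp [h]
  right_inv e := by
    ext x
    simp [x.2]

end Matching

section Wick

variable {Ω : Type*} [MeasurableSpace Ω] {P : Measure Ω}

/-- Expectation of a product of functions of independent copies: the factors are grouped by the
copy they depend on. -/
lemma integral_pi_prod_comp [IsProbabilityMeasure P] {C J : Type*} [Fintype C] [DecidableEq C]
    [Fintype J] (κ : J → C) (F : J → Ω → ℂ) :
    ∫ ω : C → Ω, ∏ j, F j (ω (κ j)) ∂(Measure.pi fun _ => P) =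
      ∏ c, ∫ ω, ∏ j with κ j = c, F j ω ∂P := by
  rw [← integral_fintype_prod_eq_prod]
  congr 1
  ext ω
  rw [← Finset.prod_fiberwise (s := Finset.univ) (g := κ)]
  refine Finset.prod_congr rfl fun c _ => Finset.prod_congr rfl fun j hj => ?_
  rw [(Finset.mem_filter.1 hj).2]

variable {Q : Type*} [Fintype Q] [DecidableEq Q]

/-- Mixed moments of independent complex Gaussian variables; `s e` tells whether the factor `e` is
conjugated. -/
lemma integral_prod_complexGaussian {v : NNReal} (hv : v ≠ 0) {g : Q → Ω → ℂ}
    (hlaw : ∀ x, HasLaw (g x) (complexGaussian v) P) (hind : iIndepFun g P)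
    {D : Type*} (A : Finset D) (s : D → Bool) (q : D → Q) :
    ∫ ω, ∏ e ∈ A, (if s e then starRingEnd ℂ (g (q e) ω) else g (q e) ω) ∂P =
      ∏ x, if (A.filter fun e => s e = false ∧ q e = x).card =
          (A.filter fun e => s e = true ∧ q e = x).card then
        (v : ℂ) ^ (A.filter fun e => s e = true ∧ q e = x).card *
          ((A.filter fun e => s e = true ∧ q e = x).card.factorial : ℂ) else 0 := by
  have h1 : ∀ ω, ∏ e ∈ A, (if s e then starRingEnd ℂ (g (q e) ω) else g (q e) ω) =
      ∏ x, (g x ω) ^ (A.filter fun e => s e = false ∧ q e = x).card *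
        (starRingEnd ℂ (g x ω)) ^ (A.filter fun e => s e = true ∧ q e = x).card := by
    intro ω
    rw [← Finset.prod_fiberwise (s := A) (g := q)]
    refine Finset.prod_congr rfl fun x _ => ?_
    rw [Finset.prod_ite, mul_comm, Finset.filter_filter, Finset.filter_filter]
    congr 1
    · rw [Finset.prod_congr rfl (g := fun _ => g x ω), Finset.prod_const]
      · congr 2
        ext e
        simp [and_comm]
      · intro e he
        rw [(Finset.mem_filter.1 he).2.1]
    · rw [Finset.prod_congr rfl (g := fun _ => starRingEnd ℂ (g x ω)), Finset.prod_const]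
      · congr 2
        ext e
        simp [and_comm]
      · intro e he
        rw [(Finset.mem_filter.1 he).2.1]
  simp_rw [h1]
  rw [hind.integral_fun_prod_comp (f := fun x z =>
      z ^ (A.filter fun e => s e = false ∧ q e = x).card *
        (starRingEnd ℂ z) ^ (A.filter fun e => s e = true ∧ q e = x).card)
    (fun x => (hlaw x).aemeasurable)
    (fun x => (Continuous.aestronglyMeasurable (by fun_prop)))]
  refine Finset.prod_congr rfl fun x _ => ?_
  rw [← integral_pow_mul_conj_pow_complexGaussian hv, ← (hlaw x).map_eq,
    integral_map (hlaw x).aemeasurable (Continuous.aestronglyMeasurable (by fun_prop))]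

/-- Wick's formula for products of independent complex Gaussian variables of variance `v`, in
independent copies indexed by `C`: each matching of the factors with the conjugated factors, of the
same variable in the same copy, contributes `v` for every pair. -/
theorem integral_prod_eq_card_matching [IsProbabilityMeasure P] {v : NNReal} (hv : v ≠ 0)
    {g : Q → Ω → ℂ}
    (hlaw : ∀ x, HasLaw (g x) (complexGaussian v) P) (hind : iIndepFun g P)
    {C D : Type*} [Fintype C] [DecidableEq C] [Fintype D] (s : D → Bool) (q : D → Q) (κ : D → C) :
    ∫ ω : C → Ω, ∏ e, (if s e then starRingEnd ℂ (g (q e) (ω (κ e))) else g (q e) (ω (κ e)))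
        ∂(Measure.pi fun _ => P) =
      (v : ℂ) ^ Fintype.card {e // s e = false} *
        Nat.card {f : D → D // (∀ e, f (f e) = e) ∧ (∀ e, s (f e) = !s e) ∧
          ∀ e, κ (f e) = κ e ∧ q (f e) = q e} := by
  have h0 : Nat.card {f : D → D // (∀ e, f (f e) = e) ∧ (∀ e, s (f e) = !s e) ∧
          ∀ e, κ (f e) = κ e ∧ q (f e) = q e} = _ :=
    (Nat.card_congr (by simpa only [Prod.mk.injEq] using
      signedInvolutionEquiv s fun e => (κ e, q e))).trans
      (card_equiv_over (fun e : {e // s e = false} => (κ e, q e))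
        (fun e : {e // s e = true} => (κ e, q e)))
  have hcard : ∀ (b : Bool) (c : C) (x : Q),
      ((Finset.univ.filter fun e => κ e = c).filter fun e => s e = b ∧ q e = x).card =
        Fintype.card {e : {e // s e = b} // ((κ e, q e) : C × Q) = (c, x)} := by
    intro b c x
    rw [Finset.filter_filter, ← Fintype.card_subtype]
    refine Fintype.card_congr
      { toFun := fun e => ⟨⟨e.1, e.2.2.1⟩, by simp [e.2.1, e.2.2.2]⟩
        invFun := fun e => ⟨e.1.1, by
          have := e.2
          simp only [Prod.mk.injEq] at this
          exact ⟨this.1, e.1.2, this.2⟩⟩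
        left_inv := fun e => rfl
        right_inv := fun e => rfl }
  rw [integral_pi_prod_comp κ (fun e ω => if s e then starRingEnd ℂ (g (q e) ω) else g (q e) ω)]
  simp_rw [integral_prod_complexGaussian hv hlaw hind, hcard]
  rw [h0, ← Fintype.prod_prod_type' (f := fun (c : C) (x : Q) =>
    if Fintype.card {e : {e // s e = false} // ((κ e, q e) : C × Q) = (c, x)} =
      Fintype.card {e : {e // s e = true} // ((κ e, q e) : C × Q) = (c, x)} then
    (v : ℂ) ^ Fintype.card {e : {e // s e = true} // ((κ e, q e) : C × Q) = (c, x)} *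
      ((Fintype.card {e : {e // s e = true} // ((κ e, q e) : C × Q) = (c, x)}).factorial : ℂ)
    else 0)]
  have hsum : Fintype.card {e // s e = false} =
      ∑ y : C × Q, Fintype.card {e : {e // s e = false} // ((κ e, q e) : C × Q) = y} := by
    rw [← Fintype.card_sigma]
    exact Fintype.card_congr (Equiv.sigmaFiberEquiv _).symm
  rw [hsum, ← Finset.prod_pow_eq_pow_sum, Nat.cast_prod, ← Finset.prod_mul_distrib]
  refine Finset.prod_congr rfl fun y _ => ?_
  split_ifs with h
  · rw [h]
  · simp

end Wick

/-! ### Traces of words as sums over closed paths -/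

section Paths

variable {N : ℕ}

lemma list_prod_map_apply_eq_sum_paths {L : Type*} (M : L → Matrix (Fin N) (Fin N) ℂ)
    (w : List L) (a b : Fin N) :
    (w.map M).prod a b = ∑ p : Fin (w.length + 1) → Fin N,
      if p 0 = a ∧ p (Fin.last _) = b then
        ∏ l : Fin w.length, M (w.get l) (p l.castSucc) (p l.succ) else 0 := by
  induction w generalizing a with
  | nil =>
    change (1 : Matrix (Fin N) (Fin N) ℂ) a b = ∑ p : Fin 1 → Fin N,
      if p 0 = a ∧ p 0 = b then ∏ l : Fin 0, M ([].get l) (p l.castSucc) (p l.succ) else 0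
    rw [← (Equiv.funUnique (Fin 1) (Fin N)).symm.sum_comp, Matrix.one_apply]
    simp [ite_and]
  | cons x w ih =>
    have hR : (∑ p : Fin ((x :: w).length + 1) → Fin N, if p 0 = a ∧ p (Fin.last _) = b then
        ∏ l : Fin (x :: w).length, M ((x :: w).get l) (p l.castSucc) (p l.succ) else 0) =
        ∑ p : Fin (w.length + 2) → Fin N, if p 0 = a ∧ p (Fin.last (w.length + 1)) = b then
          ∏ l : Fin (w.length + 1), M ((x :: w).get l) (p l.castSucc) (p l.succ) else 0 := rfl
    rw [hR, List.map_cons, List.prod_cons, Matrix.mul_apply]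
    simp_rw [ih, Finset.mul_sum]
    rw [Finset.sum_comm,
      ← (Fin.consEquiv fun _ : Fin (w.length + 2) => Fin N).sum_comp, Fintype.sum_prod_type_right]
    refine Finset.sum_congr rfl fun p _ => ?_
    rw [Fintype.sum_eq_single (p 0) fun c hc => by rw [if_neg (fun h => hc h.1.symm), mul_zero],
      Fintype.sum_eq_single a fun c hc => by
        refine if_neg fun h => hc ?_
        simpa [Fin.consEquiv] using h.1]
    have hlast : (Fin.consEquiv fun _ : Fin (w.length + 2) => Fin N) (a, p)
        (Fin.last (w.length + 1)) = p (Fin.last _) := by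
      rw [← Fin.succ_last]
      simp [Fin.consEquiv]
    rw [hlast, Fin.prod_univ_succ]
    by_cases hb : p (Fin.last _) = b
    · simp [hb, Fin.consEquiv]
    · simp [hb]

lemma trace_list_prod_map_eq_sum_paths {L : Type*} (M : L → Matrix (Fin N) (Fin N) ℂ)
    (w : List L) :
    (w.map M).prod.trace = ∑ p : Fin (w.length + 1) → Fin N,
      if p (Fin.last _) = p 0 then
        ∏ l : Fin w.length, M (w.get l) (p l.castSucc) (p l.succ) else 0 := by
  simp only [Matrix.trace, Matrix.diag_apply, list_prod_map_apply_eq_sum_paths]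
  rw [Finset.sum_comm]
  refine Finset.sum_congr rfl fun p _ => ?_
  rw [Fintype.sum_eq_single (p 0) fun c hc => if_neg fun h => hc h.1.symm]
  simp

lemma prod_trace_eq_sum_paths {k : ℕ} (ws : Fin k → StarWord)
    (M : Fin k → StarLetter → Matrix (Fin N) (Fin N) ℂ) :
    ∏ j, ((ws j).map (M j)).prod.trace = ∑ p : FacePoint ws → Fin N,
      if ∀ j, p ⟨j, Fin.last _⟩ = p ⟨j, 0⟩ then
        ∏ e : FaceEdge ws, M e.1 e.label (p e.source) (p e.target) else 0 := by
  simp_rw [trace_list_prod_map_eq_sum_paths]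
  rw [Finset.prod_univ_sum, Fintype.piFinset_univ,
    ← (Equiv.piCurry fun (j : Fin k) (_ : Fin ((ws j).length + 1)) => Fin N).sum_comp]
  refine Finset.sum_congr rfl fun p _ => ?_
  rw [Finset.prod_ite_zero, Fintype.prod_sigma]
  simp [FaceEdge.label, FaceEdge.source, FaceEdge.target, Equiv.piCurry, Sigma.curry]

end Paths

/-! ### The genus expansion -/

section GenusExpansion

variable {k : ℕ} {ws : Fin k → StarWord}

lemma AdmissiblePairing.pair_injective :
    Function.Injective (AdmissiblePairing.pair (ws := ws)) := by
  rintro ⟨f, _, _⟩ ⟨g, _, _⟩ rfl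
  rfl

noncomputable instance : Fintype (AdmissiblePairing ws) :=
  have : Finite (AdmissiblePairing ws) := Finite.of_injective _ AdmissiblePairing.pair_injective
  Fintype.ofFinite _

instance (φ : AdmissiblePairing ws) : Finite φ.Vertex := Quot.finite _

instance (φ : AdmissiblePairing ws) : Finite φ.Component := Quot.finite _

instance (φ : AdmissiblePairing ws) : Finite φ.GluedEdge := Quot.finite _

/-- The pairing respects a colouring of the faces: only edges of faces of the same colour are
paired. -/
def AdmissiblePairing.Respects {C : Type*} (φ : AdmissiblePairing ws) (κ : Fin k → C) : Prop :=
  ∀ e, κ (φ.pair e).1 = κ e.1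

/-- The contribution `N ^ (V - E)` of a pairing to the genus expansion. -/
noncomputable def AdmissiblePairing.weight (φ : AdmissiblePairing ws) (N : ℕ) : ℂ :=
  (N : ℂ) ^ Nat.card φ.Vertex / (N : ℂ) ^ Nat.card φ.GluedEdge

variable {N : ℕ} {Ω : Type*} [MeasurableSpace Ω] {P : Measure Ω}

/-- The matrix that replaces a letter. -/
def letterMatrix (G : ℕ → Matrix (Fin N) (Fin N) ℂ) (x : StarLetter) :
    Matrix (Fin N) (Fin N) ℂ :=
  if x.star then (G x.index)ᴴ else G x.index

lemma wordMatrix_eq (G : ℕ → Matrix (Fin N) (Fin N) ℂ) (w : StarWord) :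
    wordMatrix G w = (w.map (letterMatrix G)).prod := rfl

lemma letterMatrix_apply (G : ℕ → Matrix (Fin N) (Fin N) ℂ) (x : StarLetter) (a b : Fin N) :
    letterMatrix G x a b =
      if x.star then starRingEnd ℂ (G x.index b a) else G x.index a b := by
  unfold letterMatrix
  split_ifs <;> simp [Matrix.conjTranspose_apply]

lemma hasMoments_letterMatrix {G : ℕ → Ω → Matrix (Fin N) (Fin N) ℂ}
    (hG : IsGinibreSequence G P) (x : StarLetter) (a b : Fin N) :
    HasMoments P fun ω => letterMatrix (fun r => G r ω) x a b := by
  simp only [letterMatrix_apply]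
  split_ifs
  · exact (HasMoments.of_hasLaw (hG.hasLaw _ _ _)).conj
  · exact HasMoments.of_hasLaw (hG.hasLaw _ _ _)

lemma hasMoments_trace_wordMatrix [IsFiniteMeasure P] {G : ℕ → Ω → Matrix (Fin N) (Fin N) ℂ}
    (hG : IsGinibreSequence G P) (w : StarWord) :
    HasMoments P fun ω => (wordMatrix (fun r => G r ω) w).trace := by
  simp only [wordMatrix_eq, trace_list_prod_map_eq_sum_paths]
  refine HasMoments.sum _ fun p _ => ?_
  split_ifs
  · exact HasMoments.prod _ fun l _ => hasMoments_letterMatrix hG _ _ _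
  · exact HasMoments.const 0

/-- For a fixed labelling of the boundary points by indices, the matchings in Wick's formula are
the admissible pairings for which the labelling is constant on the vertices. -/
def matchingEquiv {C : Type*} (κ : Fin k → C) (p : FacePoint ws → Fin N)
    (hp : ∀ j, p ⟨j, Fin.last _⟩ = p ⟨j, 0⟩) :
    {f : FaceEdge ws → FaceEdge ws // (∀ e, f (f e) = e) ∧
      (∀ e, (f e).label.star = !e.label.star) ∧
      ∀ e, κ (f e).1 = κ e.1 ∧
        ((⟨(f e).label.index, Set.mem_range_self _⟩,
            if (f e).label.star then (p (f e).target, p (f e).source)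
              else (p (f e).source, p (f e).target)) :
            Set.range (fun e : FaceEdge ws => e.label.index) × Fin N × Fin N) =
          (⟨e.label.index, Set.mem_range_self _⟩,
            if e.label.star then (p e.target, p e.source) else (p e.source, p e.target))} ≃
      {φ : AdmissiblePairing ws // φ.Respects κ ∧ ∀ x y, φ.PointGlue x y → p x = p y} where
  toFun f := by
    refine ⟨⟨f.1, f.2.1, fun e => ?_⟩, fun e => (f.2.2.2 e).1, ?_⟩
    · have h1 := f.2.2.1 e
      have h2 := (f.2.2.2 e).2
      simp only [Prod.mk.injEq, Subtype.mk.injEq] at h2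
      cases h : (f.1 e).label
      simp_all [StarLetter.conj]
    · rintro x y (j | e)
      · exact hp j
      · have h1 := f.2.2.1 e
        have h2 := (f.2.2.2 e).2
        cases h : e.label.star <;> simp_all
  invFun φ := by
    refine ⟨φ.1.pair, φ.1.pair_pair, φ.1.star_pair, fun e => ⟨φ.2.1 e, ?_⟩⟩
    have h1 := φ.2.2 _ _ (.glue e)
    have h2 := φ.2.2 _ _ (.glue (φ.1.pair e))
    rw [φ.1.pair_pair] at h2
    have h3 := φ.1.label_pair e
    cases h : e.label.star <;> simp [h3, h, h1, h2]
  left_inv f := rfl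
  right_inv φ := rfl

lemma card_constant_on_vertices (φ : AdmissiblePairing ws) :
    Nat.card {p : FacePoint ws → Fin N // ∀ x y, φ.PointGlue x y → p x = p y} =
      N ^ Nat.card φ.Vertex := by
  have e : {p : FacePoint ws → Fin N // ∀ x y, φ.PointGlue x y → p x = p y} ≃
      (φ.Vertex → Fin N) :=
    { toFun := fun p => Quot.lift p.1 p.2
      invFun := fun f => ⟨fun x => f (Quot.mk _ x), fun x y h => congrArg f (Quot.sound h)⟩
      left_inv := fun p => rfl
      right_inv := fun f => by
        ext ⟨x⟩
        rfl }
  rw [Nat.card_congr e, Nat.card_fun, Nat.card_eq_fintype_card, Fintype.card_fin]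

open Classical in
/-- The genus expansion for Ginibre matrices in independent copies, the `j`-th word being evaluated
in the copy `κ j`: only the pairings which respect the colouring `κ` contribute. -/
theorem integral_prod_trace_eq_sum_weight [IsProbabilityMeasure P] (hN : N ≠ 0)
    {G : ℕ → Ω → Matrix (Fin N) (Fin N) ℂ} (hG : IsGinibreSequence G P)
    (ws : Fin k → StarWord) {C : Type*} [Fintype C] (κ : Fin k → C) :
    ∫ ω : C → Ω, ∏ j, (wordMatrix (fun r => G r (ω (κ j))) (ws j)).trace
        ∂(Measure.pi fun _ => P) =
      ∑ φ : AdmissiblePairing ws with φ.Respects κ, φ.weight N := by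
  have hv : (1 / N : NNReal) ≠ 0 := by positivity
  set Q := Set.range (fun e : FaceEdge ws => e.label.index) × Fin N × Fin N with hQ
  set g : Q → Ω → ℂ := fun x ω => G x.1 ω x.2.1 x.2.2 with hg
  have hlaw : ∀ x, HasLaw (g x) (complexGaussian (1 / N)) P := fun x => hG.hasLaw _ _ _
  have hind : iIndepFun g P := by
    have := hG.indep.precomp (g := fun x : Q => ((x.1 : ℕ), x.2.1, x.2.2)) (by
      rintro ⟨x, a⟩ ⟨y, b⟩ h
      simp only [Prod.mk.injEq] at h
      exact Prod.ext (Subtype.ext h.1) (Prod.ext h.2.1 h.2.2))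
    exact this
  simp only [wordMatrix_eq]
  have h1 : ∀ ω : C → Ω, ∏ j, ((ws j).map (letterMatrix fun r => G r (ω (κ j)))).prod.trace =
      ∑ p : FacePoint ws → Fin N, if ∀ j, p ⟨j, Fin.last _⟩ = p ⟨j, 0⟩ then
        ∏ e : FaceEdge ws, letterMatrix (fun r => G r (ω (κ e.1))) e.label (p e.source)
          (p e.target) else 0 := fun ω =>
    prod_trace_eq_sum_paths ws fun j => letterMatrix fun r => G r (ω (κ j))
  simp_rw [h1]
  have hint : ∀ p : FacePoint ws → Fin N, Integrable (fun ω : C → Ω =>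
      ∏ e : FaceEdge ws, letterMatrix (fun r => G r (ω (κ e.1))) e.label (p e.source)
          (p e.target)) (Measure.pi fun _ => P) := fun p =>
    HasMoments.integrable_prod _ fun e _ m =>
      (hasMoments_letterMatrix hG e.label (p e.source) (p e.target) m).comp_measurePreserving
        (measurePreserving_eval (fun _ : C => P) (κ e.1))
  rw [integral_finsetSum _ fun p _ => by
    split_ifs
    · exact hint p
    · exact integrable_const 0]
  have h2 : ∀ p : FacePoint ws → Fin N,
      (∫ ω : C → Ω, (if ∀ j, p ⟨j, Fin.last _⟩ = p ⟨j, 0⟩ then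
        ∏ e : FaceEdge ws, letterMatrix (fun r => G r (ω (κ e.1))) e.label (p e.source)
          (p e.target) else 0) ∂(Measure.pi fun _ => P)) =
      ∑ φ : AdmissiblePairing ws with φ.Respects κ,
        if ∀ x y, φ.PointGlue x y → p x = p y then (1 : ℂ) / (N : ℂ) ^ Nat.card φ.GluedEdge
          else 0 := by
    intro p
    split_ifs with hp
    · set q : FaceEdge ws → Q := fun e => (⟨e.label.index, Set.mem_range_self _⟩,
        if e.label.star then (p e.target, p e.source) else (p e.source, p e.target)) with hq
      have h3 : ∀ ω : C → Ω, ∏ e : FaceEdge ws,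
          letterMatrix (fun r => G r (ω (κ e.1))) e.label (p e.source) (p e.target) =
          ∏ e : FaceEdge ws, if e.label.star then starRingEnd ℂ (g (q e) (ω (κ e.1)))
            else g (q e) (ω (κ e.1)) := by
        intro ω
        refine Finset.prod_congr rfl fun e _ => ?_
        rw [letterMatrix_apply]
        cases h : e.label.star <;> simp [hg, hq, h]
      simp_rw [h3]
      rw [integral_prod_eq_card_matching hv hlaw hind (fun e : FaceEdge ws => e.label.star) q
        (fun e => κ e.1), Nat.card_congr (matchingEquiv κ p hp), ← Finset.sum_filter,
        Finset.filter_filter, Finset.sum_congr rfl fun φ _ => by rw [φ.card_gluedEdge],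
        Finset.sum_const, Nat.card_eq_fintype_card, nsmul_eq_mul, mul_comm]
      simp only [one_div, NNReal.coe_inv, NNReal.coe_natCast, Complex.ofReal_inv,
        Complex.ofReal_natCast, inv_pow]
      congr!
      exact Fintype.card_subtype _
    · rw [integral_zero]
      refine (Finset.sum_eq_zero fun φ _ => if_neg fun h => hp fun j => ?_).symm
      exact h _ _ (.close j)
  simp_rw [h2]
  rw [Finset.sum_comm]
  refine Finset.sum_congr rfl fun φ _ => ?_
  rw [← Finset.sum_filter, Finset.sum_const, ← Fintype.card_subtype, ← Nat.card_eq_fintype_card,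
    card_constant_on_vertices, nsmul_eq_mul, AdmissiblePairing.weight]
  push_cast
  ring

end GenusExpansion

/-! ### Centred traces -/

section Centred

variable {N : ℕ} {Ω : Type*} [MeasurableSpace Ω] {P : Measure Ω}

/-- The trace of a word in the matrices `G`, minus its expectation. -/
noncomputable def centredTrace (G : ℕ → Ω → Matrix (Fin N) (Fin N) ℂ) (P : Measure Ω)
    (w : StarWord) (ω : Ω) : ℂ :=
  (wordMatrix (fun r => G r ω) w).trace - ∫ ω', (wordMatrix (fun r => G r ω') w).trace ∂P

lemma hasMoments_centredTrace [IsFiniteMeasure P] {G : ℕ → Ω → Matrix (Fin N) (Fin N) ℂ}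
    (hG : IsGinibreSequence G P) (w : StarWord) : HasMoments P (centredTrace G P w) :=
  (hasMoments_trace_wordMatrix hG w).sub (.const _)

lemma integral_centredTrace [IsProbabilityMeasure P] {G : ℕ → Ω → Matrix (Fin N) (Fin N) ℂ}
    (hG : IsGinibreSequence G P) (w : StarWord) : ∫ ω, centredTrace G P w ω ∂P = 0 := by
  unfold centredTrace
  rw [integral_sub (hasMoments_trace_wordMatrix hG w).integrable (integrable_const _)]
  simp

lemma HasMoments.comp_eval {C : Type*} [Fintype C] [IsProbabilityMeasure P] {f : Ω → ℂ}
    (hf : HasMoments P f) (c : C) :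
    HasMoments (Measure.pi fun _ : C => P) fun ω => f (ω c) := fun p =>
  (hf p).comp_measurePreserving (measurePreserving_eval (fun _ : C => P) c)

variable {k : ℕ} {ws : Fin k → StarWord}

/-- The face `j` is a connected component of its own. -/
def AdmissiblePairing.Isolated (φ : AdmissiblePairing ws) (j : Fin k) : Prop :=
  ∀ e : FaceEdge ws, e.1 = j → (φ.pair e).1 = j

open Classical in
/-- Giving the faces of `I` colours of their own forces them to be isolated. -/
lemma AdmissiblePairing.respects_ite_iff (φ : AdmissiblePairing ws) {C : Type*} (κ : Fin k → C)
    (I : Finset (Fin k)) :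
    φ.Respects (fun j => if j ∈ I then (Sum.inl j : Fin k ⊕ C) else Sum.inr (κ j)) ↔
      φ.Respects κ ∧ ∀ j ∈ I, φ.Isolated j := by
  constructor
  · intro h
    have h' : ∀ e : FaceEdge ws, κ (φ.pair e).1 = κ e.1 ∧
        (e.1 ∈ I → (φ.pair e).1 = e.1) := by
      intro e
      have := h e
      simp only at this
      split_ifs at this with h1 h2
      · simp only [Sum.inl.injEq] at this
        simp [this]
      · simp only [Sum.inr.injEq] at this
        exact ⟨this, by tauto⟩
    refine ⟨fun e => (h' e).1, ?_⟩
    rintro j hj e rfl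
    exact (h' e).2 hj
  · rintro ⟨h1, h2⟩ e
    simp only
    by_cases he : e.1 ∈ I
    · rw [h2 _ he e rfl]
    by_cases hpe : (φ.pair e).1 ∈ I
    · have := h2 _ hpe (φ.pair e) rfl
      rw [φ.pair_pair] at this
      rw [← this] at hpe
      exact absurd hpe he
    · rw [if_neg he, if_neg hpe, h1]

/-- Expectations of products of some traces and of the expectations of others: the words of `I`
are evaluated in separate independent copies. -/
lemma prod_integral_mul_integral_prod_trace [IsProbabilityMeasure P]
    (G : ℕ → Ω → Matrix (Fin N) (Fin N) ℂ) (ws : Fin k → StarWord)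
    {C : Type*} [Fintype C] [DecidableEq C] (κ : Fin k → C) (I : Finset (Fin k)) :
    ∫ ω : Fin k ⊕ C → Ω, ∏ j, (wordMatrix
        (fun r => G r (ω (if j ∈ I then Sum.inl j else Sum.inr (κ j)))) (ws j)).trace
        ∂(Measure.pi fun _ => P) =
      (∏ j ∈ I, ∫ ω, (wordMatrix (fun r => G r ω) (ws j)).trace ∂P) *
        ∫ ω : C → Ω, ∏ j ∈ Finset.univ \ I,
          (wordMatrix (fun r => G r (ω (κ j))) (ws j)).trace ∂(Measure.pi fun _ => P) := by
  set T : Fin k → Ω → ℂ := fun j ω => (wordMatrix (fun r => G r ω) (ws j)).trace with hT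
  have h1 := integral_pi_prod_comp (P := P)
    (fun j => if j ∈ I then (Sum.inl j : Fin k ⊕ C) else Sum.inr (κ j)) T
  have h2 := integral_pi_prod_comp (P := P) κ (fun j => if j ∈ I then 1 else T j)
  have h3 : ∀ ω : C → Ω, ∏ j ∈ Finset.univ \ I, T j (ω (κ j)) =
      ∏ j, (if j ∈ I then 1 else T j) (ω (κ j)) := by
    intro ω
    rw [← Finset.prod_sdiff (Finset.subset_univ I), Finset.prod_congr rfl
      (g := fun j => (if j ∈ I then 1 else T j) (ω (κ j))) (s₁ := Finset.univ \ I)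
      fun j hj => by rw [if_neg (Finset.mem_sdiff.1 hj).2]]
    rw [Finset.prod_eq_one (s := I) fun j hj => by rw [if_pos hj]; rfl, mul_one]
  change ∫ ω : Fin k ⊕ C → Ω, ∏ j, T j (ω (if j ∈ I then Sum.inl j else Sum.inr (κ j)))
      ∂(Measure.pi fun _ => P) = (∏ j ∈ I, ∫ ω, T j ω ∂P) *
        ∫ ω : C → Ω, ∏ j ∈ Finset.univ \ I, T j (ω (κ j)) ∂(Measure.pi fun _ => P)
  simp_rw [h3]
  rw [h1, h2, Fintype.prod_sum_type]
  congr 1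
  · rw [← Finset.prod_subset (Finset.subset_univ I)]
    · refine Finset.prod_congr rfl fun i hi => ?_
      have : (Finset.univ.filter fun j =>
          (if j ∈ I then (Sum.inl j : Fin k ⊕ C) else Sum.inr (κ j)) = Sum.inl i) = {i} := by
        ext j
        simp only [Finset.mem_filter, Finset.mem_univ, true_and, Finset.mem_singleton]
        split_ifs with hj <;> grind
      simp [this]
    · intro i _ hi
      have : (Finset.univ.filter fun j =>
          (if j ∈ I then (Sum.inl j : Fin k ⊕ C) else Sum.inr (κ j)) = Sum.inl i) = ∅ := by
        ext j
        simp only [Finset.mem_filter, Finset.mem_univ, true_and, Finset.notMem_empty, iff_false]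
        split_ifs with hj <;> grind
      simp [this]
  · refine Finset.prod_congr rfl fun c _ => ?_
    congr 1
    ext ω
    rw [Finset.prod_filter, Finset.prod_filter]
    refine Finset.prod_congr rfl fun j _ => ?_
    by_cases hj : j ∈ I <;> simp [hj]

open Classical in
/-- The genus expansion of centred traces, in independent copies: centring removes the pairings
with isolated faces, by inclusion and exclusion over the set of the isolated faces. -/
theorem integral_prod_centredTrace_eq_sum_weight [IsProbabilityMeasure P] (hN : N ≠ 0)
    {G : ℕ → Ω → Matrix (Fin N) (Fin N) ℂ} (hG : IsGinibreSequence G P)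
    (ws : Fin k → StarWord) {C : Type*} [Fintype C] (κ : Fin k → C) :
    ∫ ω : C → Ω, ∏ j, centredTrace G P (ws j) (ω (κ j)) ∂(Measure.pi fun _ => P) =
      ∑ φ : AdmissiblePairing ws with φ.Respects κ ∧ ∀ j, ¬ φ.Isolated j, φ.weight N := by
  have h1 : ∀ ω : C → Ω, ∏ j, centredTrace G P (ws j) (ω (κ j)) =
      ∑ I ∈ (Finset.univ : Finset (Fin k)).powerset,
        (-1) ^ I.card * ((∏ j ∈ I, ∫ ω, (wordMatrix (fun r => G r ω) (ws j)).trace ∂P) *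
          ∏ j ∈ Finset.univ \ I, (wordMatrix (fun r => G r (ω (κ j))) (ws j)).trace) := by
    intro ω
    have := Finset.prod_add (fun j => -∫ ω, (wordMatrix (fun r => G r ω) (ws j)).trace ∂P)
      (fun j => (wordMatrix (fun r => G r (ω (κ j))) (ws j)).trace) Finset.univ
    simp only [centredTrace, sub_eq_neg_add, this, Finset.prod_neg, mul_assoc]
  simp_rw [h1]
  rw [integral_finsetSum _ fun I _ => (((HasMoments.prod _ fun j _ =>
    (hasMoments_trace_wordMatrix hG (ws j)).comp_eval (κ j)).integrable.const_mul _).const_mul _)]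
  simp_rw [integral_const_mul, ← prod_integral_mul_integral_prod_trace,
    integral_prod_trace_eq_sum_weight hN hG, AdmissiblePairing.respects_ite_iff,
    Finset.sum_filter, Finset.mul_sum]
  rw [Finset.sum_comm]
  refine Finset.sum_congr rfl fun φ _ => ?_
  have h2 : ∀ I : Finset (Fin k), (-1 : ℂ) ^ I.card *
      (if φ.Respects κ ∧ ∀ j ∈ I, φ.Isolated j then φ.weight N else 0) =
      if I ⊆ Finset.univ.filter fun j => φ.Isolated j then
        (-1 : ℂ) ^ I.card * (if φ.Respects κ then φ.weight N else 0) else 0 := by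
    intro I
    have : (I ⊆ Finset.univ.filter fun j => φ.Isolated j) ↔ ∀ j ∈ I, φ.Isolated j := by
      simp [Finset.subset_iff]
    by_cases h : φ.Respects κ <;> by_cases h' : ∀ j ∈ I, φ.Isolated j <;>
      simp only [this, h, h', true_and, false_and, if_true, if_false, mul_zero] <;> simp
  simp_rw [h2]
  rw [← Finset.sum_filter, ← Finset.sum_mul]
  have h3 : ((Finset.univ : Finset (Fin k)).powerset.filter fun I =>
      I ⊆ Finset.univ.filter fun j => φ.Isolated j) =
      (Finset.univ.filter fun j => φ.Isolated j).powerset := by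
    ext I
    simp
  have h4 := Finset.sum_powerset_neg_one_pow_card (x := Finset.univ.filter fun j => φ.Isolated j)
  have h5 : (∑ I ∈ (Finset.univ.filter fun j => φ.Isolated j).powerset, (-1 : ℂ) ^ I.card) =
      if (Finset.univ.filter fun j => φ.Isolated j) = ∅ then 1 else 0 := by
    exact_mod_cast congrArg (Int.cast : ℤ → ℂ) h4
  rw [h3, h5]
  have h6 : (Finset.univ.filter fun j => φ.Isolated j) = ∅ ↔ ∀ j, ¬ φ.Isolated j := by
    simp [Finset.filter_eq_empty_iff]
  by_cases h : φ.Respects κ <;> by_cases h' : ∀ j, ¬ φ.Isolated j <;> simp [h, h6, h']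

end Centred

/-! ### Leading order of the genus expansion -/

section Fibres

variable {A B : Type*} [Fintype A] [Finite B] {f : A → B}

lemma two_mul_card_le_of_surjective (hf : Function.Surjective f)
    (h : ∀ a, ∃ a', a' ≠ a ∧ f a' = f a) : 2 * Nat.card B ≤ Fintype.card A := by
  classical
  have := Fintype.ofFinite B
  rw [← Finset.card_univ, Finset.card_eq_sum_card_fiberwise (t := Finset.univ) (f := f) (by simp),
    Nat.card_eq_fintype_card, ← Finset.card_univ, mul_comm, ← smul_eq_mul]
  refine Finset.card_nsmul_le_sum _ _ _ fun b _ => ?_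
  obtain ⟨a, rfl⟩ := hf b
  obtain ⟨a', hne, ha'⟩ := h a
  exact Finset.one_lt_card.2 ⟨a', by simp [ha'], a, by simp, hne⟩

lemma exists_fibre_eq_pair_of_two_mul_card_eq (hf : Function.Surjective f)
    (h : ∀ a, ∃ a', a' ≠ a ∧ f a' = f a) (hcard : 2 * Nat.card B = Fintype.card A) (a : A) :
    ∃ a', a' ≠ a ∧ ∀ x, f x = f a ↔ x = a ∨ x = a' := by
  classical
  have := Fintype.ofFinite B
  have hle : ∀ b ∈ Finset.univ, 2 ≤ (Finset.univ.filter fun x => f x = b).card := by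
    intro b _
    obtain ⟨a, rfl⟩ := hf b
    obtain ⟨a', hne, ha'⟩ := h a
    exact Finset.one_lt_card.2 ⟨a', by simp [ha'], a, by simp, hne⟩
  rw [← Finset.card_univ (α := A),
    Finset.card_eq_sum_card_fiberwise (t := Finset.univ) (f := f) (by simp),
    Nat.card_eq_fintype_card, ← Finset.card_univ, mul_comm, ← smul_eq_mul,
    ← Finset.sum_const] at hcard
  have h2 := (Finset.sum_eq_sum_iff_of_le hle).1 hcard (f a) (Finset.mem_univ _)
  obtain ⟨a', hne, ha'⟩ := h a
  refine ⟨a', hne, fun x => ⟨fun hx => ?_, ?_⟩⟩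
  · have hsub : ({a, a'} : Finset A) ⊆ Finset.univ.filter fun x => f x = f a := by
      simp [Finset.insert_subset_iff, ha']
    have heq := Finset.eq_of_subset_of_card_le hsub (by rw [← h2, Finset.card_pair hne.symm])
    have : x ∈ ({a, a'} : Finset A) := by
      rw [heq]
      simp [hx]
    simpa using this
  · rintro (rfl | rfl)
    exacts [rfl, ha']

end Fibres

section LeadingOrder

variable {k : ℕ} {ws : Fin k → StarWord}

namespace AdmissiblePairing

lemma component_mk_pair (φ : AdmissiblePairing ws) (e : FaceEdge ws) :
    (Quot.mk _ (φ.pair e).1 : φ.Component) = Quot.mk _ e.1 :=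
  (Quot.sound ⟨e, rfl, rfl⟩).symm

lemma exists_ne_component_eq {φ : AdmissiblePairing ws} (h : ∀ j, ¬ φ.Isolated j) (j : Fin k) :
    ∃ j', j' ≠ j ∧ (Quot.mk _ j' : φ.Component) = Quot.mk _ j := by
  have := h j
  simp only [Isolated, not_forall] at this
  obtain ⟨e, rfl, hne⟩ := this
  exact ⟨_, hne, φ.component_mk_pair e⟩

lemma two_mul_card_component_le {φ : AdmissiblePairing ws} (h : ∀ j, ¬ φ.Isolated j) :
    2 * Nat.card φ.Component ≤ k := by
  exact (two_mul_card_le_of_surjective (f := fun j => (Quot.mk _ j : φ.Component))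
    Quot.mk_surjective (exists_ne_component_eq h)).trans_eq (Fintype.card_fin k)

/-- If no face is isolated and there are half as many components as faces, then the components
consist of two faces. -/
lemma exists_respects_pair {φ : AdmissiblePairing ws} (h : ∀ j, ¬ φ.Isolated j)
    (hc : 2 * Nat.card φ.Component = k) (i : Fin k) :
    ∃ j, j ≠ i ∧ φ.Respects fun l => decide (l = i ∨ l = j) := by
  obtain ⟨j, hne, hj⟩ := exists_fibre_eq_pair_of_two_mul_card_eq
    (f := fun j => (Quot.mk _ j : φ.Component)) Quot.mk_surjective (exists_ne_component_eq h)
    (hc.trans (Fintype.card_fin k).symm) i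
  refine ⟨j, hne, fun e => decide_eq_decide.2 ?_⟩
  rw [← hj, ← hj, component_mk_pair]

lemma eq_of_respects_pair {φ : AdmissiblePairing ws} {i : Fin k} (h : ¬ φ.Isolated i)
    {j j' : Fin k} (hj : φ.Respects fun l => decide (l = i ∨ l = j))
    (hj' : φ.Respects fun l => decide (l = i ∨ l = j')) : j = j' := by
  simp only [Isolated, not_forall] at h
  obtain ⟨e, rfl, hne⟩ := h
  have h1 := hj e
  have h2 := hj' e
  simp only [true_or, decide_true, decide_eq_true_eq, hne, false_or] at h1 h2
  exact h1.symm.trans h2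

lemma norm_weight_le {φ : AdmissiblePairing ws} {N : ℕ} (hN : N ≠ 0)
    (h : Nat.card φ.Vertex + 1 ≤ Nat.card φ.GluedEdge) : ‖φ.weight N‖ ≤ 1 / N := by
  have hN' : (1 : ℝ) ≤ N := by exact_mod_cast Nat.one_le_iff_ne_zero.2 hN
  rw [weight, norm_div, norm_pow, norm_pow, Complex.norm_natCast, div_le_div_iff₀
    (by positivity) (by positivity), one_mul, ← pow_succ]
  exact pow_le_pow_right₀ hN' h

lemma card_component_pos (φ : AdmissiblePairing ws) (j : Fin k) :
    0 < Nat.card φ.Component := by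
  have : Nonempty φ.Component := ⟨Quot.mk _ j⟩
  exact Nat.card_pos

/-- The only component of a connected surface with two faces contains both of them. -/
lemma not_isolated_of_card_component_eq_one {φ : AdmissiblePairing ws}
    (h : Nat.card φ.Component = 1) {i j : Fin k} (hij : j ≠ i) : ¬ φ.Isolated i := by
  intro hi
  have hsub : (Quot.mk _ i : φ.Component) = Quot.mk _ j :=
    (Nat.card_eq_one_iff_unique.1 h).1.elim _ _
  have h' := congrArg (Quot.lift (fun l => l = i) (by
    rintro _ _ ⟨e, rfl, rfl⟩
    refine propext ⟨fun he => hi e he, fun he => ?_⟩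
    have := hi (φ.pair e) he
    rwa [φ.pair_pair] at this)) hsub
  exact hij ((iff_of_eq h').1 rfl)

end AdmissiblePairing

variable {N : ℕ} {Ω : Type*} [MeasurableSpace Ω] {P : Measure Ω}

lemma integral_prod_unit [IsProbabilityMeasure P] (F : Fin k → Ω → ℂ) :
    ∫ ω, ∏ j, F j ω ∂P = ∫ ω : Unit → Ω, ∏ j, F j (ω ()) ∂(Measure.pi fun _ => P) := by
  rw [integral_pi_prod_comp (fun _ => ()) F]
  simp

/-- The face `i` of a pairing without isolated faces either makes up a component together with just
one further face `j`, or belongs to a larger component; pairings of the second kind have weight at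
most `1 / N`, since then `2 c < k`. -/
theorem norm_integral_prod_centredTrace_sub_le [IsProbabilityMeasure P] (hN : N ≠ 0)
    {G : ℕ → Ω → Matrix (Fin N) (Fin N) ℂ} (hG : IsGinibreSequence G P)
    (ws : Fin k → StarWord) (i : Fin k) :
    ‖(∫ ω, ∏ l, centredTrace G P (ws l) ω ∂P) - ∑ j ∈ Finset.univ.erase i,
        ∫ ω : Bool → Ω, ∏ l, centredTrace G P (ws l) (ω (decide (l = i ∨ l = j)))
          ∂(Measure.pi fun _ => P)‖ ≤ Fintype.card (AdmissiblePairing ws) / N := by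
  classical
  rw [integral_prod_unit, integral_prod_centredTrace_eq_sum_weight hN hG ws fun _ => ()]
  simp_rw [integral_prod_centredTrace_eq_sum_weight hN hG ws
    (fun l => decide (l = i ∨ l = _)), Finset.sum_filter]
  rw [Finset.sum_comm, ← Finset.sum_sub_distrib, div_eq_mul_one_div, ← nsmul_eq_mul,
    ← Finset.card_univ]
  refine norm_sum_le_of_le _ (fun φ _ => ?_) |>.trans_eq (Finset.sum_const _)
  have hr : φ.Respects fun _ => () := fun _ => rfl
  by_cases hiso : ∀ j, ¬ φ.Isolated j
  · by_cases hex : ∃ j, j ≠ i ∧ φ.Respects fun l => decide (l = i ∨ l = j)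
    · obtain ⟨j, hne, hj⟩ := hex
      rw [Finset.sum_eq_single j]
      · rw [if_pos ⟨hr, hiso⟩, if_pos ⟨hj, hiso⟩]
        simp
      · intro j' _ hj'
        exact if_neg fun h => hj' (AdmissiblePairing.eq_of_respects_pair (hiso i) h.1 hj)
      · simp [hne]
    · rw [Finset.sum_eq_zero]
      · simp only [hr, hiso, not_false_eq_true, implies_true, and_self, if_true, sub_zero]
        refine AdmissiblePairing.norm_weight_le hN ?_
        have h1 := AdmissiblePairing.two_mul_card_component_le hiso
        have h2 : 2 * Nat.card φ.Component ≠ k := fun h =>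
          hex (AdmissiblePairing.exists_respects_pair hiso h i)
        have h3 := φ.card_vertex_add_le.1
        omega
      · intro j hj
        exact if_neg fun h => hex ⟨j, (Finset.mem_erase.1 hj).1, h.1⟩
  · simp [hiso]

open Classical in
lemma sphericalCount_eq_sum (ws : Fin k → StarWord) :
    (sphericalCount ws : ℂ) = ∑ φ : AdmissiblePairing ws, if φ.IsSpherical then 1 else 0 := by
  rw [sphericalCount, Nat.card_eq_fintype_card, Fintype.card_subtype, Finset.sum_boole]

/-- A spherical pairing of a single word has weight `N`; by parity of `V - E + 1`, every other
pairing has weight at most `1 / N`. -/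
theorem norm_integral_trace_sub_le [IsProbabilityMeasure P] (hN : N ≠ 0)
    {G : ℕ → Ω → Matrix (Fin N) (Fin N) ℂ} (hG : IsGinibreSequence G P) (w : StarWord) :
    ‖(∫ ω, (wordMatrix (fun r => G r ω) w).trace ∂P) - (w.a : ℂ) * N‖ ≤
      Fintype.card (AdmissiblePairing ![w]) / N := by
  classical
  have hN' : (N : ℂ) ≠ 0 := by exact_mod_cast hN
  have h1 := integral_prod_trace_eq_sum_weight hN hG ![w] fun _ => ()
  rw [← integral_prod_unit fun j ω => (wordMatrix (fun r => G r ω) (![w] j)).trace] at h1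
  simp only [Finset.univ_unique, Finset.prod_singleton, Matrix.cons_val_fin_one] at h1
  rw [h1, StarWord.a, sphericalCount_eq_sum, Finset.sum_filter, Finset.sum_mul,
    ← Finset.sum_sub_distrib, div_eq_mul_one_div, ← nsmul_eq_mul, ← Finset.card_univ]
  refine norm_sum_le_of_le _ (fun φ _ => ?_) |>.trans_eq (Finset.sum_const _)
  have hr : φ.Respects fun _ => () := fun _ => rfl
  have hc : Nat.card φ.Component = 1 := by
    have h1 := φ.card_component_pos 0
    have h2 : Nat.card φ.Component ≤ 1 := by simp
    omega
  have hg := φ.card_vertex_add_le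
  rw [hc] at hg
  rw [if_pos hr, φ.isSpherical_iff, hc]
  simp only [true_and]
  split_ifs with hs
  · have hV : Nat.card φ.Vertex = Nat.card φ.GluedEdge + 1 := by omega
    rw [AdmissiblePairing.weight, hV, pow_succ, mul_div_cancel_left₀ _ (pow_ne_zero _ hN')]
    simp
  · rw [zero_mul, sub_zero]
    exact AdmissiblePairing.norm_weight_le hN (by grind)

/-- A pairing of two words without isolated faces is connected; the spherical ones have weight `1`
and, by parity, the others weight at most `1 / N`. -/
theorem norm_integral_centredTrace_mul_sub_le [IsProbabilityMeasure P] (hN : N ≠ 0)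
    {G : ℕ → Ω → Matrix (Fin N) (Fin N) ℂ} (hG : IsGinibreSequence G P) (w w' : StarWord) :
    ‖(∫ ω, centredTrace G P w ω * centredTrace G P w' ω ∂P) - sphericalCount ![w, w']‖ ≤
      Fintype.card (AdmissiblePairing ![w, w']) / N := by
  classical
  have hN' : (N : ℂ) ≠ 0 := by exact_mod_cast hN
  have h1 := integral_prod_centredTrace_eq_sum_weight hN hG ![w, w'] fun _ => ()
  rw [← integral_prod_unit fun j ω => centredTrace G P (![w, w'] j) ω] at h1
  simp only [Fin.prod_univ_two, Matrix.cons_val_zero, Matrix.cons_val_one] at h1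
  rw [h1, sphericalCount_eq_sum, Finset.sum_filter,
    ← Finset.sum_sub_distrib, div_eq_mul_one_div, ← nsmul_eq_mul, ← Finset.card_univ]
  refine norm_sum_le_of_le _ (fun φ _ => ?_) |>.trans_eq (Finset.sum_const _)
  have hr : φ.Respects fun _ => () := fun _ => rfl
  by_cases hiso : ∀ j, ¬ φ.Isolated j
  · have hc : Nat.card φ.Component = 1 := by
      have h1 := φ.card_component_pos 0
      have h2 := AdmissiblePairing.two_mul_card_component_le hiso
      omega
    have hg := φ.card_vertex_add_le
    rw [hc] at hg
    rw [if_pos ⟨hr, hiso⟩, φ.isSpherical_iff, hc]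
    simp only [true_and]
    split_ifs with hs
    · have hV : Nat.card φ.Vertex = Nat.card φ.GluedEdge := by omega
      rw [AdmissiblePairing.weight, hV, div_self (pow_ne_zero _ hN')]
      simp
    · rw [sub_zero]
      exact AdmissiblePairing.norm_weight_le hN (by grind)
  · have hs : ¬ φ.IsSpherical := by
      intro hs
      refine hiso fun j => ?_
      obtain ⟨i, hi⟩ := exists_ne j
      exact AdmissiblePairing.not_isolated_of_card_component_eq_one hs.1 hi
    simp [hiso, hs]

end LeadingOrder

/-! ### The method of moments for Gaussian limits -/

section MethodOfMoments

open Nat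

lemma norm_cexp_mul_I_sub_sum_le_of_nonneg (n : ℕ) {x : ℝ} (hx : 0 ≤ x) :
    ‖Complex.exp (x * Complex.I) - ∑ k ∈ Finset.range n, (x * Complex.I) ^ k / (k ! : ℂ)‖ ≤
      x ^ n / n ! := by
  induction n generalizing x with
  | zero => simp [Complex.norm_exp_ofReal_mul_I]
  | succ n ih =>
    have hd : ∀ y : ℝ, HasDerivAt (fun y : ℝ => Complex.exp (y * Complex.I) -
        ∑ k ∈ Finset.range (n + 1), (y * Complex.I) ^ k / k !)
        (Complex.I * (Complex.exp (y * Complex.I) -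
          ∑ k ∈ Finset.range n, (y * Complex.I) ^ k / k !)) y := by
      intro y
      have h0 : HasDerivAt (fun y : ℝ => (y : ℂ) * Complex.I) Complex.I y := by
        simpa using (Complex.ofRealCLM.hasDerivAt (x := y)).mul_const Complex.I
      have h1 := h0.cexp
      have h2 : ∀ k ∈ Finset.range n, HasDerivAt
          (fun y : ℝ => ((y : ℂ) * Complex.I) ^ (k + 1) / ((k + 1)! : ℂ))
          (Complex.I * ((y * Complex.I) ^ k / k !)) y := by
        intro k _
        refine ((h0.pow (k + 1)).div_const ((k + 1)! : ℂ)).congr_deriv ?_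
        have h3 : (k ! : ℂ) ≠ 0 := by exact_mod_cast k.factorial_ne_zero
        have h4 : ((k : ℂ) + 1) ≠ 0 := by exact_mod_cast k.succ_ne_zero
        rw [Nat.factorial_succ]
        push_cast
        field_simp
      have h3 := h1.sub ((HasDerivAt.fun_sum h2).add_const 1)
      rw [← Finset.mul_sum] at h3
      refine (h3.congr_deriv (by ring)).congr_of_eventuallyEq (Eventually.of_forall fun y => ?_)
      simp [Finset.sum_range_succ']
    have hB : ∀ y : ℝ, HasDerivAt (fun y : ℝ => y ^ (n + 1) / ((n + 1)! : ℝ)) (y ^ n / n !) y := by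
      intro y
      refine ((hasDerivAt_pow (n + 1) y).div_const ((n + 1)! : ℝ)).congr_deriv ?_
      have h3 : (n ! : ℝ) ≠ 0 := by exact_mod_cast n.factorial_ne_zero
      rw [Nat.factorial_succ]
      push_cast
      field_simp
    refine image_norm_le_of_norm_deriv_right_le_deriv_boundary (a := 0) (b := x)
      (fun y _ => (hd y).continuousAt.continuousWithinAt)
      (fun y _ => (hd y).hasDerivWithinAt) ?_ hB ?_ ⟨hx, le_rfl⟩
    · simp [Finset.sum_range_succ']
    · rintro y ⟨hy, -⟩
      rw [norm_mul, Complex.norm_I, one_mul]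
      exact ih hy

/-- Taylor's formula for the characters of the real line. -/
lemma norm_cexp_mul_I_sub_sum_le (n : ℕ) (x : ℝ) :
    ‖Complex.exp (x * Complex.I) - ∑ k ∈ Finset.range n, (x * Complex.I) ^ k / (k ! : ℂ)‖ ≤
      |x| ^ n / n ! := by
  rcases le_total 0 x with hx | hx
  · rw [abs_of_nonneg hx]
    exact norm_cexp_mul_I_sub_sum_le_of_nonneg n hx
  · have h := norm_cexp_mul_I_sub_sum_le_of_nonneg n (neg_nonneg.2 hx)
    rw [abs_of_nonpos hx, ← Complex.norm_conj]
    convert h using 2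
    rw [map_sub, ← Complex.exp_conj, map_sum]
    simp

/-- If the moments converge to those of the centred Gaussian law of variance `v`, characterized by
the recursion `g (n + 2) = (n + 1) v g n`, then the characteristic functions converge at `1`. -/
theorem tendsto_integral_cexp_of_tendsto_moments {Ω : ℕ → Type*} [∀ N, MeasurableSpace (Ω N)]
    {P : (N : ℕ) → Measure (Ω N)} [∀ N, IsProbabilityMeasure (P N)]
    {X : (N : ℕ) → Ω N → ℝ} (hX : ∀ N, HasMoments (P N) fun ω => (X N ω : ℂ)) {v : ℝ} {g : ℕ → ℝ}
    (g0 : g 0 = 1) (g1 : g 1 = 0) (g2 : ∀ n, g (n + 2) = (n + 1) * v * g n)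
    (h : ∀ n, Tendsto (fun N => ∫ ω, X N ω ^ n ∂(P N)) atTop (𝓝 (g n))) :
    Tendsto (fun N => ∫ ω, Complex.exp (X N ω * Complex.I) ∂(P N)) atTop
      (𝓝 (Complex.exp (-(v / 2 : ℝ)))) := by
  have hodd : ∀ m, g (2 * m + 1) = 0 := by
    intro m
    induction m with
    | zero => exact g1
    | succ m ih => rw [show 2 * (m + 1) + 1 = 2 * m + 1 + 2 by ring, g2, ih, mul_zero]
  have heven : ∀ m, g (2 * m) / (2 * m)! = (v / 2) ^ m / m ! := by
    intro m
    induction m with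
    | zero => simp [g0]
    | succ m ih =>
      have h1 : ((2 * (m + 1))! : ℝ) = (2 * m + 2) * (2 * m + 1) * (2 * m)! := by
        rw [show 2 * (m + 1) = 2 * m + 1 + 1 by ring, Nat.factorial_succ, Nat.factorial_succ]
        push_cast
        ring
      have h2 : ((m + 1)! : ℝ) = (m + 1) * m ! := by
        rw [Nat.factorial_succ]
        push_cast
        ring
      rw [show 2 * (m + 1) = 2 * m + 2 by ring] at h1 ⊢
      rw [g2, h1, h2, pow_succ]
      have h3 : ((2 * m)! : ℝ) ≠ 0 := by exact_mod_cast (2 * m).factorial_ne_zero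
      have h4 : (m ! : ℝ) ≠ 0 := by exact_mod_cast m.factorial_ne_zero
      have h5 : (m : ℝ) + 1 ≠ 0 := by positivity
      have h6 : (2 * m : ℝ) + 1 ≠ 0 := by positivity
      have h7 : (2 * m : ℝ) + 2 ≠ 0 := by positivity
      have ih' : g (2 * m) = (v / 2) ^ m / m ! * (2 * m)! := by rw [← ih]; field_simp
      rw [ih']
      push_cast
      field_simp
  have hint : ∀ N n, Integrable (fun ω => X N ω ^ n) (P N) := by
    intro N n
    have := (HasMoments.integrable_prod (Finset.range n) fun _ _ => hX N).re
    simpa [← Complex.ofReal_pow] using this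
  have hmeas : ∀ N, AEStronglyMeasurable (X N) (P N) := fun N => by
    simpa using (hX N).integrable.re.aestronglyMeasurable
  set S : ℕ → ℂ := fun m => ∑ k ∈ Finset.range (2 * m), Complex.I ^ k / k ! * g k with hS
  have hS' : ∀ m, S m = ∑ j ∈ Finset.range m, (-(v / 2 : ℝ) : ℂ) ^ j / j ! := by
    intro m
    induction m with
    | zero => simp [hS]
    | succ m ih =>
      have : S (m + 1) = S m + Complex.I ^ (2 * m) / (2 * m)! * g (2 * m) +
          Complex.I ^ (2 * m + 1) / (2 * m + 1)! * g (2 * m + 1) := by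
        simp only [hS]
        rw [show 2 * (m + 1) = 2 * m + 1 + 1 by ring, Finset.sum_range_succ, Finset.sum_range_succ]
      rw [this, ih, Finset.sum_range_succ, hodd, pow_mul, Complex.I_sq]
      have h1 : (g (2 * m) : ℂ) / (2 * m)! = (v / 2 : ℝ) ^ m / m ! := by
        exact_mod_cast congrArg (Complex.ofReal) (heven m)
      rw [div_mul_eq_mul_div, mul_div_assoc, h1, neg_pow ((v / 2 : ℝ) : ℂ)]
      simp
      ring
  have hSlim : Tendsto S atTop (𝓝 (Complex.exp (-(v / 2 : ℝ)))) := by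
    have := (NormedSpace.expSeries_div_hasSum_exp (-(v / 2 : ℝ) : ℂ)).tendsto_sum_nat
    rw [← Complex.exp_eq_exp_ℂ] at this
    exact this.congr fun m => (hS' m).symm
  have hglim : Tendsto (fun m => g (2 * m) / (2 * m)!) atTop (𝓝 0) := by
    simp_rw [heven]
    exact FloorSemiring.tendsto_pow_div_factorial_atTop _
  -- Truncated Taylor series: the error is bounded by an even moment.
  have hbound : ∀ N m, ‖(∫ ω, Complex.exp (X N ω * Complex.I) ∂(P N)) -
      ∑ k ∈ Finset.range (2 * m), Complex.I ^ k / k ! * (∫ ω, X N ω ^ k ∂(P N) : ℝ)‖ ≤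
      (∫ ω, X N ω ^ (2 * m) ∂(P N)) / (2 * m)! := by
    intro N m
    have h1 : ∀ k, Complex.I ^ k / k ! * ((∫ ω, X N ω ^ k ∂(P N) : ℝ) : ℂ) =
        ∫ ω, ((X N ω : ℂ) * Complex.I) ^ k / (k ! : ℂ) ∂(P N) := by
      intro k
      rw [← integral_complex_ofReal, ← integral_const_mul]
      congr 1
      ext ω
      push_cast
      ring
    have h2 : ∀ k, Integrable (fun ω => ((X N ω : ℂ) * Complex.I) ^ k / (k ! : ℂ)) (P N) := by
      intro k
      have := ((hint N k).ofReal (𝕜 := ℂ)).const_mul (Complex.I ^ k / (k ! : ℂ))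
      refine this.congr (ae_of_all _ fun ω => ?_)
      simp only [RCLike.ofReal_pow, Complex.coe_algebraMap]
      ring
    have h3 : Integrable (fun ω => Complex.exp (X N ω * Complex.I)) (P N) := by
      refine Integrable.of_bound (C := 1) ?_ (ae_of_all _ fun ω => ?_)
      · exact (Continuous.comp_aestronglyMeasurable
          (g := fun x : ℝ => Complex.exp (x * Complex.I)) (by fun_prop) (hmeas N))
      · rw [Complex.norm_exp_ofReal_mul_I]
    simp_rw [h1]
    rw [← integral_finsetSum _ fun k _ => h2 k,
      ← integral_sub h3 (integrable_finsetSum _ fun k _ => h2 k), ← integral_div]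
    refine norm_integral_le_of_norm_le ((hint N (2 * m)).div_const _) (ae_of_all _ fun ω => ?_)
    refine (norm_cexp_mul_I_sub_sum_le _ _).trans_eq ?_
    rw [(even_two_mul m).pow_abs]
  rw [Metric.tendsto_atTop']
  intro ε hε
  have e1 := (Metric.tendsto_nhds.1 hSlim (ε / 3) (by positivity))
  have e2 := (hglim.eventually (gt_mem_nhds (show 0 < ε / 3 by positivity)))
  obtain ⟨m, hm1, hm2⟩ := (e1.and e2).exists
  have l1 : Tendsto (fun N => ∑ k ∈ Finset.range (2 * m),
      Complex.I ^ k / k ! * ((∫ ω, X N ω ^ k ∂(P N) : ℝ) : ℂ)) atTop (𝓝 (S m)) :=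
    tendsto_finsetSum _ fun k _ =>
      ((Complex.continuous_ofReal.tendsto _).comp (h k)).const_mul _
  have l2 := ((h (2 * m)).div_const ((2 * m)! : ℝ)).eventually (gt_mem_nhds hm2)
  have l3 := Metric.tendsto_nhds.1 l1 (ε / 3) (by positivity)
  obtain ⟨N₀, hN₀⟩ := eventually_atTop.1 (l2.and l3)
  refine ⟨N₀, fun N hN => ?_⟩
  obtain ⟨b1, b2⟩ := hN₀ N hN.le
  have b3 := hbound N m
  rw [dist_eq_norm] at *
  calc _ ≤ _ := norm_sub_le_norm_sub_add_norm_sub _ (∑ k ∈ Finset.range (2 * m),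
      Complex.I ^ k / k ! * ((∫ ω, X N ω ^ k ∂(P N) : ℝ) : ℂ)) _
    _ ≤ _ := add_le_add_right (norm_sub_le_norm_sub_add_norm_sub _ (S m) _) _
    _ < ε := by linarith

end MethodOfMoments

/-! ### Moments of linear combinations of traces -/

section LinearCombinations

variable {N : ℕ} {Ω : Type*} [MeasurableSpace Ω] {P : Measure Ω}

/-- The linear combination `∑ b, α b * Tr (G_{W b})` of centred traces. -/
noncomputable def traceComb (G : ℕ → Ω → Matrix (Fin N) (Fin N) ℂ) (P : Measure Ω)
    (W : Bool → StarWord) (α : Bool → ℂ) (ω : Ω) : ℂ :=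
  ∑ b, α b * centredTrace G P (W b) ω

lemma integral_prod_traceComb [IsProbabilityMeasure P]
    {G : ℕ → Ω → Matrix (Fin N) (Fin N) ℂ} (hG : IsGinibreSequence G P)
    (W : Bool → StarWord) (α : Bool → ℂ) {k : ℕ} {C : Type*} [Fintype C] (κ : Fin k → C) :
    ∫ ω : C → Ω, ∏ l, traceComb G P W α (ω (κ l)) ∂(Measure.pi fun _ => P) =
      ∑ ε : Fin k → Bool, (∏ l, α (ε l)) *
        ∫ ω : C → Ω, ∏ l, centredTrace G P (W (ε l)) (ω (κ l)) ∂(Measure.pi fun _ => P) := by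
  simp only [traceComb, Finset.prod_univ_sum, Fintype.piFinset_univ, Finset.prod_mul_distrib]
  rw [integral_finsetSum _ fun ε _ => ((HasMoments.integrable_prod _ fun l _ =>
    (hasMoments_centredTrace hG (W (ε l))).comp_eval (κ l)).const_mul _)]
  simp_rw [integral_const_mul]

lemma integral_prod_traceComb_pair [IsProbabilityMeasure P]
    (F : Ω → ℂ) {n : ℕ} {i j : Fin (n + 2)} (hij : j ≠ i) :
    ∫ ω : Bool → Ω, ∏ l : Fin (n + 2), F (ω (decide (l = i ∨ l = j)))
        ∂(Measure.pi fun _ => P) = (∫ ω, F ω ^ 2 ∂P) * ∫ ω, F ω ^ n ∂P := by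
  have h1 : (Finset.univ.filter fun l => decide (l = i ∨ l = j) = true) = {i, j} := by
    ext l
    simp
  have h2 : (Finset.univ.filter fun l => decide (l = i ∨ l = j) = false) =
      Finset.univ \ {i, j} := by
    ext l
    simp
  rw [integral_pi_prod_comp (fun l => decide (l = i ∨ l = j)) fun _ => F, Fintype.prod_bool]
  simp_rw [Finset.prod_const]
  rw [h1, h2, Finset.card_pair hij.symm, Finset.card_sdiff_of_subset (Finset.subset_univ _),
    Finset.card_pair hij.symm, Finset.card_univ, Fintype.card_fin, Nat.add_sub_cancel]

/-- The moments of a linear combination of traces satisfy, up to `O(1/N)`, the recursion of the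
moments of a centred Gaussian variable. -/
theorem norm_integral_traceComb_pow_sub_le [IsProbabilityMeasure P] (hN : N ≠ 0)
    {G : ℕ → Ω → Matrix (Fin N) (Fin N) ℂ} (hG : IsGinibreSequence G P)
    (W : Bool → StarWord) (α : Bool → ℂ) (n : ℕ) :
    ‖(∫ ω, traceComb G P W α ω ^ (n + 2) ∂P) - (n + 1) *
      ((∫ ω, traceComb G P W α ω ^ 2 ∂P) * ∫ ω, traceComb G P W α ω ^ n ∂P)‖ ≤
      (∑ ε : Fin (n + 2) → Bool, ‖∏ l, α (ε l)‖ *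
        Fintype.card (AdmissiblePairing fun l => W (ε l))) / N := by
  have h1 : ∫ ω, traceComb G P W α ω ^ (n + 2) ∂P = ∑ ε : Fin (n + 2) → Bool,
      (∏ l, α (ε l)) * ∫ ω, ∏ l, centredTrace G P (W (ε l)) ω ∂P := by
    have h := integral_prod_traceComb hG W α fun _ : Fin (n + 2) => ()
    rw [← integral_prod_unit fun (_ : Fin (n + 2)) ω => traceComb G P W α ω] at h
    simp only [Finset.prod_const, Finset.card_univ, Fintype.card_fin] at h
    rw [h]
    refine Finset.sum_congr rfl fun ε _ => ?_
    rw [← integral_prod_unit fun l ω => centredTrace G P (W (ε l)) ω]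
  have h2 : ((n : ℂ) + 1) * ((∫ ω, traceComb G P W α ω ^ 2 ∂P) *
      ∫ ω, traceComb G P W α ω ^ n ∂P) = ∑ ε : Fin (n + 2) → Bool, (∏ l, α (ε l)) *
        ∑ j ∈ Finset.univ.erase (0 : Fin (n + 2)), ∫ ω : Bool → Ω,
          ∏ l, centredTrace G P (W (ε l)) (ω (decide (l = 0 ∨ l = j)))
            ∂(Measure.pi fun _ => P) := by
    simp_rw [Finset.mul_sum]
    rw [Finset.sum_comm]
    simp_rw [← integral_prod_traceComb hG W α]
    rw [Finset.sum_congr rfl fun j hj =>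
      integral_prod_traceComb_pair (traceComb G P W α) (Finset.mem_erase.1 hj).1,
      Finset.sum_const, Finset.card_erase_of_mem (Finset.mem_univ _), Finset.card_univ,
      Fintype.card_fin, nsmul_eq_mul]
    push_cast
    ring
  rw [h1, h2, ← Finset.sum_sub_distrib, Finset.sum_div]
  refine norm_sum_le_of_le _ fun ε _ => ?_
  rw [← mul_sub, norm_mul, mul_div_assoc]
  exact mul_le_mul_of_nonneg_left
    (norm_integral_prod_centredTrace_sub_le hN hG (fun l => W (ε l)) 0) (norm_nonneg _)

lemma wordMatrix_adjoint (G : ℕ → Matrix (Fin N) (Fin N) ℂ) (w : StarWord) :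
    wordMatrix G w.adjoint = (wordMatrix G w)ᴴ := by
  rw [wordMatrix_eq, wordMatrix_eq, StarWord.adjoint, Matrix.conjTranspose_list_prod,
    List.map_reverse, List.map_map, List.map_map]
  congr 3
  ext x : 1
  cases h : x.star <;> simp [letterMatrix, StarLetter.conj, h]

lemma centredTrace_adjoint (G : ℕ → Ω → Matrix (Fin N) (Fin N) ℂ) (w : StarWord) (ω : Ω) :
    centredTrace G P w.adjoint ω = starRingEnd ℂ (centredTrace G P w ω) := by
  simp only [centredTrace, wordMatrix_adjoint, Matrix.trace_conjTranspose, map_sub,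
    ← integral_conj]
  rfl

end LinearCombinations

/-! ### The limit theorem -/

section Limit

variable {Ω : ℕ → Type*} [∀ N, MeasurableSpace (Ω N)]
  {P : (N : ℕ) → Measure (Ω N)} [∀ N, IsProbabilityMeasure (P N)]
  {G : (N : ℕ) → ℕ → Ω N → Matrix (Fin N) (Fin N) ℂ}

lemma tendsto_of_norm_sub_le_div {f : ℕ → ℂ} {a : ℂ} {K : ℝ}
    (h : ∀ N : ℕ, N ≠ 0 → ‖f N - a‖ ≤ K / N) : Tendsto f atTop (𝓝 a) := by
  rw [tendsto_iff_norm_sub_tendsto_zero]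
  refine squeeze_zero' (Eventually.of_forall fun _ => norm_nonneg _) ?_
    (tendsto_const_div_atTop_nhds_zero_nat K)
  filter_upwards [eventually_ne_atTop 0] with N hN using h N hN

lemma tendsto_integral_sq_centredTrace (hG : ∀ N, IsGinibreSequence (G N) (P N)) (w : StarWord) :
    Tendsto (fun N => ∫ ω, centredTrace (G N) (P N) w ω ^ 2 ∂(P N)) atTop (𝓝 w.c) := by
  refine tendsto_of_norm_sub_le_div (K := Fintype.card (AdmissiblePairing ![w, w]))
    fun N hN => ?_
  simp_rw [sq]
  exact norm_integral_centredTrace_mul_sub_le hN (hG N) w w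

lemma tendsto_integral_mul_conj_centredTrace (hG : ∀ N, IsGinibreSequence (G N) (P N))
    (w : StarWord) :
    Tendsto (fun N => ∫ ω, centredTrace (G N) (P N) w ω *
      starRingEnd ℂ (centredTrace (G N) (P N) w ω) ∂(P N)) atTop (𝓝 w.b) := by
  refine tendsto_of_norm_sub_le_div (K := Fintype.card (AdmissiblePairing ![w, w.adjoint]))
    fun N hN => ?_
  simp_rw [← centredTrace_adjoint]
  exact norm_integral_centredTrace_mul_sub_le hN (hG N) w w.adjoint

/-- The real inner product of a centred trace with `t`, as a linear combination of the traces of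
`w` and of its adjoint. -/
lemma inner_centredTrace_eq_traceComb {N : ℕ} {Ω : Type*} [MeasurableSpace Ω] {P : Measure Ω}
    (G : ℕ → Ω → Matrix (Fin N) (Fin N) ℂ) (w : StarWord) (t : ℂ) (ω : Ω) :
    ((inner ℝ (centredTrace G P w ω) t : ℝ) : ℂ) =
      traceComb G P (fun b => if b then w.adjoint else w)
        (fun b => if b then t / 2 else starRingEnd ℂ t / 2) ω := by
  simp only [traceComb, Fintype.sum_bool, if_true, Bool.false_eq_true, if_false,
    centredTrace_adjoint, Complex.inner]
  apply Complex.ext <;> simp <;> ring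

lemma hasMoments_inner_centredTrace {N : ℕ} {Ω : Type*} [MeasurableSpace Ω] {P : Measure Ω}
    [IsProbabilityMeasure P] {G : ℕ → Ω → Matrix (Fin N) (Fin N) ℂ} (hG : IsGinibreSequence G P)
    (w : StarWord) (t : ℂ) :
    HasMoments P fun ω => ((inner ℝ (centredTrace G P w ω) t : ℝ) : ℂ) := by
  simp_rw [inner_centredTrace_eq_traceComb]
  exact HasMoments.sum _ fun b _ => (HasMoments.const _).mul (hasMoments_centredTrace hG _)

/-- The limiting variance of the real inner product of the centred trace with `t`. -/
noncomputable def limitVariance (w : StarWord) (t : ℂ) : ℝ :=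
  ((w.b : ℝ) + w.c) / 2 * t.re ^ 2 + ((w.b : ℝ) - w.c) / 2 * t.im ^ 2

lemma tendsto_integral_inner_centredTrace_sq (hG : ∀ N, IsGinibreSequence (G N) (P N))
    (w : StarWord) (t : ℂ) :
    Tendsto (fun N => ∫ ω, (inner ℝ (centredTrace (G N) (P N) w ω) t : ℝ) ^ 2 ∂(P N)) atTop
      (𝓝 (limitVariance w t)) := by
  have h1 := tendsto_integral_sq_centredTrace hG w
  have h2 := tendsto_integral_mul_conj_centredTrace hG w
  have h3 : Tendsto (fun N => starRingEnd ℂ (∫ ω, centredTrace (G N) (P N) w ω ^ 2 ∂(P N))) atTop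
      (𝓝 w.c) := by
    have := (Complex.continuous_conj.tendsto _).comp h1
    rwa [Complex.conj_natCast] at this
  have h4 := ((h1.const_mul (starRingEnd ℂ t ^ 2 / 4)).add
    (h2.const_mul (t * starRingEnd ℂ t / 2))).add (h3.const_mul (t ^ 2 / 4))
  have h5 : starRingEnd ℂ t ^ 2 / 4 * (w.c : ℂ) + t * starRingEnd ℂ t / 2 * (w.b : ℂ) +
      t ^ 2 / 4 * (w.c : ℂ) = (limitVariance w t : ℝ) := by
    apply Complex.ext <;> simp [limitVariance, sq] <;> ring
  rw [h5] at h4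
  have h6 := (Complex.continuous_re.tendsto _).comp h4
  refine h6.congr fun N => ?_
  have hm := hasMoments_centredTrace (hG N) w
  have i1 : Integrable (fun ω => centredTrace (G N) (P N) w ω ^ 2) (P N) := by
    simpa [sq] using (hm.mul hm).integrable
  have i3 : Integrable (fun ω => starRingEnd ℂ (centredTrace (G N) (P N) w ω ^ 2)) (P N) := by
    simpa [sq] using (hm.mul hm).conj.integrable
  have i12 : Integrable (fun ω => starRingEnd ℂ t ^ 2 / 4 * centredTrace (G N) (P N) w ω ^ 2 +
      t * starRingEnd ℂ t / 2 * (centredTrace (G N) (P N) w ω *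
        starRingEnd ℂ (centredTrace (G N) (P N) w ω))) (P N) :=
    (i1.const_mul _).add ((hm.mul hm.conj).integrable.const_mul _)
  simp only [Function.comp_apply]
  rw [← integral_conj, ← integral_const_mul, ← integral_const_mul, ← integral_const_mul,
    ← integral_add (i1.const_mul _) ((hm.mul hm.conj).integrable.const_mul _),
    ← integral_add i12 (i3.const_mul _),
    ← Complex.ofReal_re (∫ ω, (inner ℝ (centredTrace (G N) (P N) w ω) t : ℝ) ^ 2 ∂(P N)),
    ← integral_complex_ofReal]
  congr 2
  ext ω
  push_cast
  rw [inner_centredTrace_eq_traceComb]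
  simp only [traceComb, Fintype.sum_bool, if_true, Bool.false_eq_true, if_false,
    centredTrace_adjoint, map_pow]
  ring

/-- The moments of a centred Gaussian variable of variance `v`. -/
def gaussianMoment (v : ℝ) : ℕ → ℝ
  | 0 => 1
  | 1 => 0
  | n + 2 => (n + 1) * v * gaussianMoment v n

lemma tendsto_integral_inner_centredTrace_pow (hG : ∀ N, IsGinibreSequence (G N) (P N))
    (w : StarWord) (t : ℂ) (n : ℕ) :
    Tendsto (fun N => ∫ ω, (inner ℝ (centredTrace (G N) (P N) w ω) t : ℝ) ^ n ∂(P N)) atTop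
      (𝓝 (gaussianMoment (limitVariance w t) n)) := by
  induction n using Nat.twoStepInduction with
  | zero => simp [gaussianMoment]
  | one =>
    have : ∀ N, ∫ ω, (inner ℝ (centredTrace (G N) (P N) w ω) t : ℝ) ^ 1 ∂(P N) = 0 := by
      intro N
      rw [← Complex.ofReal_inj, ← integral_complex_ofReal]
      simp_rw [pow_one, inner_centredTrace_eq_traceComb, traceComb]
      rw [integral_finsetSum _ fun b _ =>
        (hasMoments_centredTrace (hG N) _).integrable.const_mul _]
      simp [integral_const_mul, integral_centredTrace (hG N)]
    simp only [this, gaussianMoment]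
    exact tendsto_const_nhds
  | more n ih _ =>
    set f : ℕ → ℕ → ℝ := fun n N =>
      ∫ ω, (inner ℝ (centredTrace (G N) (P N) w ω) t : ℝ) ^ n ∂(P N) with hf
    have h2 : Tendsto (fun N => (n + 1 : ℝ) * (f 2 N * f n N)) atTop
        (𝓝 (gaussianMoment (limitVariance w t) (n + 2))) := by
      rw [gaussianMoment, mul_assoc]
      exact ((tendsto_integral_inner_centredTrace_sq hG w t).mul ih).const_mul _
    set K : ℝ := ∑ ε : Fin (n + 2) → Bool,
      ‖∏ l, if ε l then t / 2 else starRingEnd ℂ t / 2‖ *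
        Fintype.card (AdmissiblePairing fun l => if ε l then w.adjoint else w) with hK
    have h3 : ∀ N, N ≠ 0 → |f (n + 2) N - (n + 1 : ℝ) * (f 2 N * f n N)| ≤ K / N := by
      intro N hN
      have h := norm_integral_traceComb_pow_sub_le hN (hG N)
        (fun b => if b then w.adjoint else w)
        (fun b => if b then t / 2 else starRingEnd ℂ t / 2) n
      simp_rw [← inner_centredTrace_eq_traceComb, ← Complex.ofReal_pow,
        integral_complex_ofReal] at h
      rw [← Real.norm_eq_abs, ← Complex.norm_real]
      simpa [hf, hK] using h
    have h4 : Tendsto (fun N => f (n + 2) N - (n + 1 : ℝ) * (f 2 N * f n N)) atTop (𝓝 0) := by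
      refine squeeze_zero_norm' ?_ (tendsto_const_div_atTop_nhds_zero_nat K)
      filter_upwards [eventually_ne_atTop 0] with N hN using h3 N hN
    have h5 := h4.add h2
    simp only [sub_add_cancel, zero_add] at h5
    exact h5

/-- The characteristic function of the centred trace converges to that of a Gaussian law. -/
lemma tendsto_charFun_centredTrace (hG : ∀ N, IsGinibreSequence (G N) (P N))
    (w : StarWord) (t : ℂ) :
    Tendsto (fun N => ∫ ω, Complex.exp
      ((inner ℝ (centredTrace (G N) (P N) w ω) t : ℝ) * Complex.I) ∂(P N)) atTop
      (𝓝 (Complex.exp (-(limitVariance w t / 2 : ℝ)))) :=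
  tendsto_integral_cexp_of_tendsto_moments
    (fun N => hasMoments_inner_centredTrace (hG N) w t) rfl rfl (fun _ => rfl)
    (tendsto_integral_inner_centredTrace_pow hG w t)

/-- `(b_w - c_w) / 2` is the limit of the variances of the imaginary part of the trace. -/
lemma StarWord.c_le_b (hG : ∀ N, IsGinibreSequence (G N) (P N)) (w : StarWord) : w.c ≤ w.b := by
  have h := ge_of_tendsto' (tendsto_integral_inner_centredTrace_sq hG w Complex.I)
    fun N => integral_nonneg fun ω => sq_nonneg _
  simp only [limitVariance, Complex.I_re, Complex.I_im] at h
  have : (w.c : ℝ) ≤ w.b := by linarith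
  exact_mod_cast this

/-- The characteristic function of `X + i Y` for independent centred Gaussian variables `X`, `Y`. -/
lemma charFun_map_add_I_mul {Ω : Type*} [MeasurableSpace Ω] {P : Measure Ω}
    [IsProbabilityMeasure P] {X Y : Ω → ℝ} {u v : NNReal}
    (hX : HasLaw X (gaussianReal 0 u) P) (hY : HasLaw Y (gaussianReal 0 v) P)
    (hXY : IndepFun X Y P) (t : ℂ) :
    charFun (P.map fun ω => (X ω : ℂ) + Complex.I * (Y ω : ℂ)) t =
      Complex.exp (-((u * t.re ^ 2 + v * t.im ^ 2) / 2 : ℝ)) := by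
  have hXm := hX.aemeasurable
  have hYm := hY.aemeasurable
  have hchar : ∀ {Z : Ω → ℝ} {s : NNReal} (_ : HasLaw Z (gaussianReal 0 s) P) (r : ℝ),
      ∫ ω, Complex.exp (r * Z ω * Complex.I) ∂P = Complex.exp (-((s * r ^ 2) / 2 : ℝ)) := by
    intro Z s hZ r
    have h := charFun_gaussianReal (μ := 0) (v := s) r
    rw [← hZ.map_eq, charFun_apply_real,
      integral_map hZ.aemeasurable (Continuous.aestronglyMeasurable (by fun_prop))] at h
    rw [h]
    congr 1
    push_cast
    ring
  rw [charFun_apply, integral_map (by fun_prop) (Continuous.aestronglyMeasurable (by fun_prop))]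
  have h1 : ∀ ω, Complex.exp ((inner ℝ ((X ω : ℂ) + Complex.I * (Y ω : ℂ)) t : ℝ) * Complex.I) =
      Complex.exp (t.re * X ω * Complex.I) * Complex.exp (t.im * Y ω * Complex.I) := by
    intro ω
    rw [← Complex.exp_add, Complex.inner]
    congr 1
    simp
    ring
  simp_rw [h1]
  have hind : IndepFun (fun ω => Complex.exp (t.re * X ω * Complex.I))
      (fun ω => Complex.exp (t.im * Y ω * Complex.I)) P :=
    hXY.comp (φ := fun x : ℝ => Complex.exp (t.re * x * Complex.I))
      (ψ := fun y : ℝ => Complex.exp (t.im * y * Complex.I)) (by fun_prop) (by fun_prop)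
  rw [hind.integral_fun_mul_eq_mul_integral (AEMeasurable.aestronglyMeasurable (by fun_prop))
    (AEMeasurable.aestronglyMeasurable (by fun_prop)), hchar hX, hchar hY, ← Complex.exp_add]
  congr 1
  push_cast
  ring

end Limit

theorem mainTheorem1 (w : StarWord)
    {Ω : ℕ → Type*} [∀ N, MeasurableSpace (Ω N)]
    (P : (N : ℕ) → Measure (Ω N)) [∀ N, IsProbabilityMeasure (P N)]
    (G : (N : ℕ) → ℕ → Ω N → Matrix (Fin N) (Fin N) ℂ)
    (hG : ∀ N, IsGinibreSequence (G N) (P N))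
    {Ω' : Type*} [MeasurableSpace Ω'] (P' : Measure Ω') [IsProbabilityMeasure P']
    (X Y : Ω' → ℝ)
    (hX : HasLaw X (gaussianReal 0 (Real.toNNReal (((w.b : ℝ) + w.c) / 2))) P')
    (hY : HasLaw Y (gaussianReal 0 (Real.toNNReal (((w.b : ℝ) - w.c) / 2))) P')
    (hXY : IndepFun X Y P') :
    w.c ≤ w.b ∧
    (∀ N, Integrable (fun ω => (wordMatrix (fun r => G N r ω) w).trace) (P N)) ∧
    (fun N : ℕ => (∫ ω, (wordMatrix (fun r => G N r ω) w).trace ∂(P N)) - (w.a : ℂ) * N)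
      =O[atTop] (fun N : ℕ => (1 : ℝ) / N) ∧
    TendstoInDistribution
      (fun N ω => (wordMatrix (fun r => G N r ω) w).trace - (w.a : ℂ) * N) atTop
      (fun ω => (X ω : ℂ) + Complex.I * (Y ω : ℂ)) P P' := by
  have hcb : w.c ≤ w.b := StarWord.c_le_b hG w
  have hint : ∀ N, Integrable (fun ω => (wordMatrix (fun r => G N r ω) w).trace) (P N) :=
    fun N => (hasMoments_trace_wordMatrix (hG N) w).integrable
  set K : ℝ := ((Fintype.card (AdmissiblePairing ![w]) : ℕ) : ℝ)
  set δ : ℕ → ℂ := fun N =>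
    (∫ ω, (wordMatrix (fun r => G N r ω) w).trace ∂(P N)) - (w.a : ℂ) * N with hδ
  have hδK : ∀ N, N ≠ 0 → ‖δ N‖ ≤ K / N := fun N hN => norm_integral_trace_sub_le hN (hG N) w
  have hδ0 : Tendsto δ atTop (𝓝 0) :=
    tendsto_of_norm_sub_le_div (K := K) fun N hN => by simpa using hδK N hN
  have hmeas : ∀ N, AEMeasurable
      (fun ω => (wordMatrix (fun r => G N r ω) w).trace - (w.a : ℂ) * N) (P N) := fun N =>
    (hint N).aemeasurable.sub_const _
  have hXm := hX.aemeasurable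
  have hYm := hY.aemeasurable
  refine ⟨hcb, hint, ?_, hmeas, by fun_prop, ?_⟩
  · refine IsBigO.of_bound K ?_
    filter_upwards [eventually_ne_atTop 0] with N hN
    simpa [div_eq_mul_inv] using hδK N hN
  · refine ProbabilityMeasure.tendsto_iff_tendsto_charFun.2 fun t => ?_
    -- Without this inequality `Real.toNNReal` would truncate the variance of `Y`.
    have hcb' : (w.c : ℝ) ≤ w.b := by exact_mod_cast hcb
    have hlim : charFun (P'.map fun ω => (X ω : ℂ) + Complex.I * (Y ω : ℂ)) t =
        Complex.exp (-(limitVariance w t / 2 : ℝ)) := by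
      rw [charFun_map_add_I_mul hX hY hXY, Real.coe_toNNReal _ (by positivity),
        Real.coe_toNNReal _ (by linarith), limitVariance]
    -- The constants `a_w N` and `E Tr G_w` differ by `δ N → 0`, which only contributes a phase.
    have hpre : ∀ N, charFun ((P N).map
        fun ω => (wordMatrix (fun r => G N r ω) w).trace - (w.a : ℂ) * N) t =
        Complex.exp ((inner ℝ (δ N) t : ℝ) * Complex.I) * ∫ ω, Complex.exp
          ((inner ℝ (centredTrace (G N) (P N) w ω) t : ℝ) * Complex.I) ∂(P N) := by
      intro N
      rw [charFun_apply,
        integral_map (hmeas N) (Continuous.aestronglyMeasurable (by fun_prop)),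
        ← integral_const_mul]
      congr 1
      ext ω
      rw [← Complex.exp_add, ← add_mul, ← Complex.ofReal_add, ← inner_add_left]
      congr 5
      simp only [hδ, centredTrace]
      ring
    have h1 : Tendsto (fun N => Complex.exp ((inner ℝ (δ N) t : ℝ) * Complex.I)) atTop (𝓝 1) := by
      have hcont : Continuous fun z : ℂ => Complex.exp ((inner ℝ z t : ℝ) * Complex.I) := by
        fun_prop
      have h := (hcont.tendsto 0).comp hδ0
      rw [inner_zero_left, Complex.ofReal_zero, zero_mul, Complex.exp_zero] at h
      exact h
    have h2 := h1.mul (tendsto_charFun_centredTrace hG w t)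
    rw [one_mul, ← hlim] at h2
    exact h2.congr fun N => (hpre N).symm
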